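/- **Setting.** Let $L=L_{\mathcal R}\cup L_{\mathcal F}$ be a (possibly infinite) language consisting of relation symbols $R\in L_{\mathcal R}$, each of a finite arity $a(R)\ge 1$, and unary function symbols $F\in L_{\mathcal F}$. Let $\Gamma_L$ be a group of permutations of $L$ which map relation symbols to relation symbols of the same arity and function symbols to function symbols. A *$\Gamma_L$-structure* $\mathbf A$ is a (possibly empty) vertex set $A$ with relations $R_{\mathbf A}\subseteq A^{a(R)}$ for $R\in L_{\mathcal R}$ and functions $F_{\mathbf A}\colon A\to\mathcal P(A)$ for $F\in L_{\mathcal F}$; it is finite if $A$ is finite. *Maps.* An *embedding* $f\colon\mathbf A\to\mathbf B$ is a pair $(f_L,f_A)$ with $f_L\in\Gamma_L$ and $f_A\colon A\to B$ injective such that $\bar x\in R_{\mathbf A}\iff f_A(\bar x)\in f_L(R)_{\mathbf B}$ and $f_A(F_{\mathbf A}(x))=f_L(F)_{\mathbf B}(f_A(x))$ for all $R$, $F$, $\bar x$, $x$. Embeddings are composed in both coordinates. An *isomorphism* is an embedding with $f_A$ bijective; an *automorphism* is an isomorphism from a structure to itself. $\mathbf A$ is a *substructure* of $\mathbf B$ if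 $A\subseteq B$ and $(\mathrm{id}_L,\text{inclusion})$ is an embedding; substructures of $\mathbf B$ correspond to the subsets of $B$ closed under all functions of $\mathbf B$. For an embedding $\psi\colon \mathbf A\to\mathbf B$, $\psi(\mathbf A)$ is the substructure of $\mathbf B$ with vertex set $\psi(A)$. *Relabelling.* $g\in\Gamma_L$ acts on the $\Gamma_L$-structures with vertex set $A$ by $R_{g\mathbf A}=(g^{-1}R)_{\mathbf A}$ and $F_{g\mathbf A}=(g^{-1}F)_{\mathbf A}$. *Amalgamation.* Let $\alpha_i\colon\mathbf A\to\mathbf B_i$ ($i=1,2$) be embeddings. A structure $\mathbf C$ with embeddings $\beta_i\colon\mathbf B_i\to\mathbf C$ is an *amalgamation* of $\mathbf B_1,\mathbf B_2$ over $\mathbf A$ with respect to $\alpha_1,\alpha_2$ if $\beta_1\alpha_1=\beta_2\alpha_2$ (also for the language parts). It is *free* if moreover $\beta_1(x_1)=\beta_2(x_2)$ holds if and only if $x_1=\alpha_1(a)$ and $x_2=\alpha_2(a)$ for some $a\in A$; $C=\beta_1(B_1)\cup\beta_2(B_2)$; and no tuple in a relation of $\mathbf C$ contains vertices of both $\beta_1(B_1\setminus\alpha_1(A))$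 and $\beta_2(B_2\setminus\alpha_2(A))$. A structure is *irreducible* if it is not the free amalgamation of two of its proper substructures over their intersection (with respect to the inclusions). A *free amalgamation class* is an isomorphism-closed class $\mathcal K$ of finite $\Gamma_L$-structures such that every structure which embeds into a member of $\mathcal K$ is in $\mathcal K$; any two members of $\mathcal K$ embed into a common member of $\mathcal K$; and for all $\mathbf A,\mathbf B_1,\mathbf B_2\in\mathcal K$ and embeddings $\alpha_i\colon\mathbf A\to\mathbf B_i$ some $\mathbf C\in\mathcal K$ is, with suitable $\beta_1,\beta_2$, a free amalgamation of $\mathbf B_1,\mathbf B_2$ over $\mathbf A$ with respect to $\alpha_1,\alpha_2$. *EPPA.* A *partial automorphism* of a structure is an isomorphism between two of its substructures; it *extends* to an automorphism $\theta$ if $\theta$ has the same language part and agrees with it on its domain. An embedding $\psi\colon\mathbf A\to\mathbf B$ is an *EPPA-witness* if every partial automorphism of $\psi(\mathbf A)$ extends to an automorphism of $\mathbf B$. It is *coherent* if one can choose for each partial automorphism $f$ of $\psi(\mathbf A)$ an automorphism $\hat f$ of $\mathbf B$ extending $f$ so that $\hat h=\hat g\circ\hat f$ whenever $\mathrm{Dom}(f)=\mathrm{Dom}(h)$,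 $\mathrm{Range}(f)=\mathrm{Dom}(g)$, $\mathrm{Range}(g)=\mathrm{Range}(h)$ and $h=g\circ f$. It is *irreducible structure faithful* if for every irreducible substructure $\mathbf D$ of $\mathbf B$ there is an automorphism $g$ of $\mathbf B$ with $g(D)\subseteq\psi(A)$. A class $\mathcal K$ of finite $\Gamma_L$-structures has *EPPA* (respectively *irreducible structure faithful coherent EPPA*) if for every $\mathbf A\in\mathcal K$ there are $\mathbf B\in\mathcal K$ and an embedding $\psi\colon\mathbf A\to\mathbf B$ which is an EPPA-witness (respectively an irreducible structure faithful coherent EPPA-witness). **Statement.** Let $\mathcal K$ be a free amalgamation class of finite $\Gamma_L$-structures. Then $\mathcal K$ has EPPA if and only if every $\mathbf A\in\mathcal K$ lies in a finite orbit of the action of $\Gamma_L$ on $\Gamma_L$-structures by relabelling. Moreover, if $\mathcal K$ has EPPA, then it has irreducible structure faithful coherent EPPA. -/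

import Mathlib

universe u v w

namespace GammaL

/-- A language consisting of relation symbols (`Rel n` is the set of relation symbols of
arity `n`, arities being at least `1`) and of unary function symbols. -/
structure UnaryLanguage where
  Rel : ℕ → Type u
  rel_zero : IsEmpty (Rel 0)
  Fn : Type v

/-- The group of all permutations of the language which preserve types and arities of symbols.
A language equipped with a permutation group is a language `L` with a subgroup of `L.Perm`. -/
abbrev UnaryLanguage.Perm (L : UnaryLanguage.{u, v}) : Type (max u v) :=
  (∀ n, Equiv.Perm (L.Rel n)) × Equiv.Perm L.Fn

/-- An interpretation of the symbols of `L` on a vertex set `V`. The value of a function symbol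
at a vertex is a set of vertices. -/
@[ext]
structure Interp (L : UnaryLanguage.{u, v}) (V : Type w) where
  rel : ∀ n, L.Rel n → Set (Fin n → V)
  fn : L.Fn → V → Set V

/-- The action by relabelling: `g • S` interprets a symbol `s` as `S` interprets `g⁻¹ s`. -/
instance (L : UnaryLanguage.{u, v}) (V : Type w) : MulAction L.Perm (Interp L V) where
  smul g S :=
    { rel := fun n r => S.rel n ((g⁻¹).1 n r)
      fn := fun F => S.fn ((g⁻¹).2 F) }
  one_smul _ := rfl
  mul_smul g h S := by
    have e : (g * h)⁻¹ = h⁻¹ * g⁻¹ := mul_inv_rev g h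
    change Interp.mk _ _ = Interp.mk _ _
    rw [e]
    rfl

/-- A structure: a vertex set with an interpretation of the symbols of `L`. -/
structure Struc (L : UnaryLanguage.{u, v}) where
  V : Type w
  str : Interp L V

section Maps

variable {L : UnaryLanguage.{u, v}}

/-- An embedding: a permutation of the language from `Γ` together with an injective map of the
vertices, which preserve and reflect relations and commute with functions. -/
structure Embedding (Γ : Subgroup L.Perm) (A B : Struc.{u, v, w} L) where
  lang : Γ
  toFun : A.V → B.V
  injective : Function.Injective toFun
  map_rel : ∀ n (r : L.Rel n) (x : Fin n → A.V),
    x ∈ A.str.rel n r ↔ toFun ∘ x ∈ B.str.rel n (lang.1.1 n r)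
  map_fn : ∀ (F : L.Fn) (x : A.V), toFun '' A.str.fn F x = B.str.fn (lang.1.2 F) (toFun x)

/-- Composition of embeddings (`f` first), on the language and on the vertices. -/
def Embedding.comp {Γ : Subgroup L.Perm} {A B C : Struc.{u, v, w} L}
    (g : Embedding Γ B C) (f : Embedding Γ A B) : Embedding Γ A C where
  lang := g.lang * f.lang
  toFun := g.toFun ∘ f.toFun
  injective := g.injective.comp f.injective
  map_rel n r x := (f.map_rel n r x).trans (g.map_rel n _ _)
  map_fn F x := by
    rw [Set.image_comp, f.map_fn, g.map_fn]
    rfl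

/-- An isomorphism: an embedding which is bijective on vertices. -/
structure Iso (Γ : Subgroup L.Perm) (A B : Struc.{u, v, w} L) extends Embedding Γ A B where
  surjective : Function.Surjective toFun

/-- Substructures of `A` correspond to sets of vertices closed under all functions. -/
structure Substruc (A : Struc.{u, v, w} L) where
  verts : Set A.V
  closed : ∀ (F : L.Fn), ∀ x ∈ verts, A.str.fn F x ⊆ verts

/-- The structure which a closed set of vertices carries. -/
def Substruc.toStruc {A : Struc.{u, v, w} L} (S : Substruc A) : Struc.{u, v, w} L where
  V := S.verts
  str :=
    { rel := fun n r => {x | (fun i => (x i : A.V)) ∈ A.str.rel n r}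
      fn := fun F x => {y | (y : A.V) ∈ A.str.fn F x} }

/-- The inclusion between two substructures, with the identity on the language. -/
def Substruc.inclusion (Γ : Subgroup L.Perm) {A : Struc.{u, v, w} L} {S T : Substruc A}
    (h : S.verts ⊆ T.verts) : Embedding Γ S.toStruc T.toStruc where
  lang := 1
  toFun := Set.inclusion h
  injective := Set.inclusion_injective h
  map_rel _ _ _ := Iff.rfl
  map_fn F x := by
    ext y
    constructor
    · rintro ⟨z, hz, rfl⟩
      exact hz
    · intro hy
      exact ⟨⟨y.1, S.closed F x.1 x.2 hy⟩, hy, rfl⟩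

/-- The inclusion of a substructure, with the identity on the language. -/
def Substruc.subtype (Γ : Subgroup L.Perm) {A : Struc.{u, v, w} L} (S : Substruc A) :
    Embedding Γ S.toStruc A where
  lang := 1
  toFun := Subtype.val
  injective := Subtype.val_injective
  map_rel _ _ _ := Iff.rfl
  map_fn F x := by
    ext y
    constructor
    · rintro ⟨z, hz, rfl⟩
      exact hz
    · intro hy
      exact ⟨⟨y, S.closed F x.1 x.2 hy⟩, hy, rfl⟩

/-- The intersection of two substructures. -/
def Substruc.inter {A : Struc.{u, v, w} L} (S T : Substruc A) : Substruc A where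
  verts := S.verts ∩ T.verts
  closed F x hx := Set.subset_inter (S.closed F x hx.1) (T.closed F x hx.2)

/-- The image `ψ(A)` of an embedding `ψ : A → B`, a substructure of `B`. -/
def Embedding.range {Γ : Subgroup L.Perm} {A B : Struc.{u, v, w} L} (ψ : Embedding Γ A B) :
    Substruc B where
  verts := Set.range ψ.toFun
  closed := by
    rintro F _ ⟨x, rfl⟩
    have h := ψ.map_fn (ψ.lang.1.2.symm F) x
    rw [Equiv.apply_symm_apply] at h
    rw [← h]
    exact Set.image_subset_range _ _

/-! ### Amalgamation -/

/-- `C` with `β₁`, `β₂` is an amalgamation of `B₁` and `B₂` over `A` with respect to `α₁`, `α₂`;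
the equality of the compositions includes their language parts. -/
def IsAmalgamation {Γ : Subgroup L.Perm} {A B₁ B₂ C : Struc.{u, v, w} L}
    (α₁ : Embedding Γ A B₁) (α₂ : Embedding Γ A B₂)
    (β₁ : Embedding Γ B₁ C) (β₂ : Embedding Γ B₂ C) : Prop :=
  β₁.comp α₁ = β₂.comp α₂

/-- The amalgamation is strong: the images of `B₁` and `B₂` meet only in the image of `A`. -/
def IsStrongAmalgamation {Γ : Subgroup L.Perm} {A B₁ B₂ C : Struc.{u, v, w} L}
    (α₁ : Embedding Γ A B₁) (α₂ : Embedding Γ A B₂)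
    (β₁ : Embedding Γ B₁ C) (β₂ : Embedding Γ B₂ C) : Prop :=
  IsAmalgamation α₁ α₂ β₁ β₂ ∧
    ∀ x₁ x₂, β₁.toFun x₁ = β₂.toFun x₂ ↔ ∃ a, α₁.toFun a = x₁ ∧ α₂.toFun a = x₂

/-- The amalgamation is free: it is strong, `C` is the union of the images of `B₁` and `B₂`, and
no tuple in a relation of `C` has vertices both in `β₁(B₁ \ α₁(A))` and in `β₂(B₂ \ α₂(A))`.
(There is no condition on functions: these are unary, and a single vertex does not lie in both
of these disjoint sets.) -/
def IsFreeAmalgamation {Γ : Subgroup L.Perm} {A B₁ B₂ C : Struc.{u, v, w} L}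
    (α₁ : Embedding Γ A B₁) (α₂ : Embedding Γ A B₂)
    (β₁ : Embedding Γ B₁ C) (β₂ : Embedding Γ B₂ C) : Prop :=
  IsStrongAmalgamation α₁ α₂ β₁ β₂ ∧
    Set.range β₁.toFun ∪ Set.range β₂.toFun = Set.univ ∧
    ∀ n (r : L.Rel n) (x : Fin n → C.V),
      (∃ i, x i ∈ β₁.toFun '' (Set.range α₁.toFun)ᶜ) →
      (∃ j, x j ∈ β₂.toFun '' (Set.range α₂.toFun)ᶜ) →
      x ∉ C.str.rel n r

/-- A structure is irreducible if it is not the free amalgamation of two proper substructures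
(over their intersection, with respect to the inclusions). -/
def Irreducible (Γ : Subgroup L.Perm) (C : Struc.{u, v, w} L) : Prop :=
  ¬ ∃ S T : Substruc C, S.verts ≠ Set.univ ∧ T.verts ≠ Set.univ ∧
    IsFreeAmalgamation
      (Substruc.inclusion Γ (S := S.inter T) (T := S) Set.inter_subset_left)
      (Substruc.inclusion Γ (S := S.inter T) (T := T) Set.inter_subset_right)
      (S.subtype Γ) (T.subtype Γ)

/-- An amalgamation class of finite structures. -/
structure IsAmalgamationClass (Γ : Subgroup L.Perm) (K : Set (Struc.{u, v, w} L)) : Prop where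
  finite : ∀ A ∈ K, Finite A.V
  closed_iso : ∀ A ∈ K, ∀ B, Nonempty (Iso Γ A B) → B ∈ K
  hereditary : ∀ A ∈ K, ∀ B, Nonempty (Embedding Γ B A) → B ∈ K
  joint_embedding : ∀ A ∈ K, ∀ B ∈ K,
    ∃ C ∈ K, Nonempty (Embedding Γ A C) ∧ Nonempty (Embedding Γ B C)
  amalgamation : ∀ A ∈ K, ∀ B₁ ∈ K, ∀ B₂ ∈ K,
    ∀ (α₁ : Embedding Γ A B₁) (α₂ : Embedding Γ A B₂),
      ∃ C ∈ K, ∃ (β₁ : Embedding Γ B₁ C) (β₂ : Embedding Γ B₂ C), IsAmalgamation α₁ α₂ β₁ β₂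

/-- A free amalgamation class: the amalgamation can always be chosen to be free. -/
structure IsFreeAmalgamationClass (Γ : Subgroup L.Perm) (K : Set (Struc.{u, v, w} L)) : Prop
    extends IsAmalgamationClass Γ K where
  free_amalgamation : ∀ A ∈ K, ∀ B₁ ∈ K, ∀ B₂ ∈ K,
    ∀ (α₁ : Embedding Γ A B₁) (α₂ : Embedding Γ A B₂),
      ∃ C ∈ K, ∃ (β₁ : Embedding Γ B₁ C) (β₂ : Embedding Γ B₂ C), IsFreeAmalgamation α₁ α₂ β₁ β₂

/-! ### EPPA -/

/-- A partial automorphism of `B`: an isomorphism (including a permutation of the language from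
`Γ`) between two substructures of `B`. -/
structure PartialAut (Γ : Subgroup L.Perm) (B : Struc.{u, v, w} L) where
  dom : Substruc B
  cod : Substruc B
  iso : Iso Γ dom.toStruc cod.toStruc

/-- The value of a partial automorphism at a vertex of its domain, as a vertex of `B`. -/
def PartialAut.app {Γ : Subgroup L.Perm} {B : Struc.{u, v, w} L} (p : PartialAut Γ B)
    (x : p.dom.verts) : B.V :=
  (p.cod.subtype Γ).toFun (p.iso.toFun x)

/-- `p` is a partial automorphism of the substructure `S` of `B`. -/
def PartialAut.IsOn {Γ : Subgroup L.Perm} {B : Struc.{u, v, w} L} (p : PartialAut Γ B)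
    (S : Substruc B) : Prop :=
  p.dom.verts ⊆ S.verts ∧ p.cod.verts ⊆ S.verts

/-- The automorphism `θ` of `B` extends `p`, with the same permutation of the language. -/
def PartialAut.ExtendsTo {Γ : Subgroup L.Perm} {B : Struc.{u, v, w} L} (p : PartialAut Γ B)
    (θ : Iso Γ B B) : Prop :=
  θ.lang = p.iso.lang ∧ ∀ x : p.dom.verts, θ.toFun x = p.app x

/-- `(f, g, h)` is a coherent triple: `Dom f = Dom h`, `Range f = Dom g`, `Range g = Range h` and
`h = g ∘ f` (on the language and on the vertices). -/
def CoherentTriple {Γ : Subgroup L.Perm} {B : Struc.{u, v, w} L} (f g h : PartialAut Γ B) : Prop :=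
  f.dom.verts = h.dom.verts ∧ f.cod.verts = g.dom.verts ∧ g.cod.verts = h.cod.verts ∧
    h.iso.lang = g.iso.lang * f.iso.lang ∧
    ∀ (x : f.dom.verts) (y : g.dom.verts) (z : h.dom.verts),
      (z : B.V) = x → (y : B.V) = f.app x → h.app z = g.app y

/-- The embedding `ψ : A → B` makes `B` an EPPA-witness for `A`. -/
def IsEPPAEmbedding {Γ : Subgroup L.Perm} {A B : Struc.{u, v, w} L} (ψ : Embedding Γ A B) : Prop :=
  ∀ p : PartialAut Γ B, p.IsOn ψ.range → ∃ θ : Iso Γ B B, p.ExtendsTo θ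

/-- The embedding `ψ : A → B` makes `B` a coherent EPPA-witness for `A`: all partial automorphisms
of `ψ(A)` extend to automorphisms of `B` in such a way that coherent triples are mapped to
coherent triples. As automorphisms are defined everywhere, coherence of their triples
just says that the third is the composition of the first two. -/
def IsCoherentEPPAEmbedding {Γ : Subgroup L.Perm} {A B : Struc.{u, v, w} L}
    (ψ : Embedding Γ A B) : Prop :=
  ∃ φ : {p : PartialAut Γ B // p.IsOn ψ.range} → Iso Γ B B,
    (∀ p : {p : PartialAut Γ B // p.IsOn ψ.range}, p.1.ExtendsTo (φ p)) ∧
    ∀ f g h : {p : PartialAut Γ B // p.IsOn ψ.range}, CoherentTriple f.1 g.1 h.1 →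
      (φ h).toEmbedding = (φ g).toEmbedding.comp (φ f).toEmbedding

/-- `B` is irreducible structure faithful with respect to `ψ(A)`: every irreducible substructure
of `B` is sent into `ψ(A)` by an automorphism of `B`. -/
def IsIrreducibleStructureFaithful {Γ : Subgroup L.Perm} {A B : Struc.{u, v, w} L}
    (ψ : Embedding Γ A B) : Prop :=
  ∀ C : Substruc B, Irreducible Γ C.toStruc →
    ∃ g : Iso Γ B B, g.toFun '' C.verts ⊆ ψ.range.verts

/-- The extension property for partial automorphisms (EPPA) of a class. -/
def HasEPPA (Γ : Subgroup L.Perm) (K : Set (Struc.{u, v, w} L)) : Prop :=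
  ∀ A ∈ K, ∃ B ∈ K, ∃ ψ : Embedding Γ A B, IsEPPAEmbedding ψ

/-- Irreducible structure faithful coherent EPPA of a class. -/
def HasFaithfulCoherentEPPA (Γ : Subgroup L.Perm) (K : Set (Struc.{u, v, w} L)) : Prop :=
  ∀ A ∈ K, ∃ B ∈ K, ∃ ψ : Embedding Γ A B,
    IsCoherentEPPAEmbedding ψ ∧ IsIrreducibleStructureFaithful ψ

end Maps

end GammaL

/-! If EPPA holds and `B` is a witness for `A`, every `g ∈ Γ` is, up to conjugation by the language
part of `ψ`, the language part of an empty partial automorphism of `ψ(A)`. It extends to an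
automorphism `θ` of `B`, and `g • A.str` can be read off from the vertex map `θ ∘ ψ`. There are
finitely many maps from `A` to `B`, so the orbit is finite (`IsEPPAEmbedding.finite_orbit`).

Conversely, a witness for `A` is glued from translates of a copy `ι(A)` in a finite set `V` under a
group `H` of permutations labelled by `Γ`. Three properties are needed: partial automorphisms of `A`
extend coherently to elements of `H`; elements of `H` preserve the structure wherever they move base
vertices to base vertices; and a set of vertices lies in one translate as soon as any two of its
vertices do.

The first two hold in `A × (J → ZMod p)`, with `J` the finite sets of vertices paired with
interpretations from the orbit of `A` (`exists_parity_cover`). Finiteness of the orbit makes `J`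
finite. The group acts by affine maps whose translation parts sum to zero over each finite set; a
map that changed the structure on such a set while keeping it in the base would translate it by a
nonzero constant, which is impossible. The third property comes from a further cover, where a
pigeonhole argument rules out sets that fit into no translate (`exists_conformal_cover`).

To define functions, each vertex of the glued structure also carries its closure. Any two vertices
of an irreducible substructure lie in a common translate, so the third property gives faithfulness.
Irreducible substructures of the witness therefore embed into `A`, and free amalgamation puts the
whole witness into `K` (`IsFreeAmalgamationClass.mem_of_irreducible`). -/

namespace GammaL

open Equiv (Perm)

/-! ### Coherent extension of partial bijections of finite sets -/

/-- A relation is the graph of a partial bijection. -/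
def IsPartialBij {N N' : Type*} (R : SetRel N N') : Prop :=
  ∀ x y x' y', (x, y) ∈ R → (x', y') ∈ R → (x = x' ↔ y = y')

theorem IsPartialBij.ncard_dom_eq {N N' : Type*} {R : SetRel N N'} (hR : IsPartialBij R) :
    R.dom.ncard = R.cod.ncard := by
  have h1 : (Prod.fst '' R).ncard = Set.ncard R :=
    Set.InjOn.ncard_image fun p hp q hq h => Prod.ext h ((hR _ _ _ _ hp hq).1 h)
  have h2 : (Prod.snd '' R).ncard = Set.ncard R :=
    Set.InjOn.ncard_image fun p hp q hq h => Prod.ext ((hR _ _ _ _ hp hq).2 h) h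
  have e1 : R.dom = Prod.fst '' R := by ext; simp [SetRel.dom]
  have e2 : R.cod = Prod.snd '' R := by ext; simp [SetRel.cod]
  rw [e1, e2, h1, h2]

theorem dom_comp_of_cod_eq {N : Type*} {R S : SetRel N N} (h : R.cod = S.dom) :
    (R.comp S).dom = R.dom := by
  ext x
  constructor
  · rintro ⟨z, y, hxy, -⟩
    exact ⟨y, hxy⟩
  · rintro ⟨y, hxy⟩
    obtain ⟨z, hz⟩ : y ∈ S.dom := h ▸ ⟨x, hxy⟩
    exact ⟨z, y, hxy, hz⟩

theorem cod_comp_of_cod_eq {N : Type*} {R S : SetRel N N} (h : R.cod = S.dom) :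
    (R.comp S).cod = S.cod := by
  ext z
  constructor
  · rintro ⟨x, y, -, hyz⟩
    exact ⟨y, hyz⟩
  · rintro ⟨y, hyz⟩
    obtain ⟨x, hx⟩ : y ∈ R.cod := h ▸ ⟨z, hyz⟩
    exact ⟨x, y, hx, hyz⟩

theorem exists_enumeration {N : Type*} [Finite N] (X : Set N) :
    ∃ e : N → ℕ, Set.InjOn e X ∧ e '' X = Set.Iio X.ncard := by
  classical
  let f : X ≃ Fin X.ncard := Finite.equivFinOfCardEq (Nat.card_coe_set_eq X)
  refine ⟨fun x => if h : x ∈ X then f ⟨x, h⟩ else 0, ?_, ?_⟩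
  · intro x hx y hy h
    simp only [hx, hy, dif_pos] at h
    have := f.injective (Fin.ext h)
    exact congrArg Subtype.val this
  · ext i
    constructor
    · rintro ⟨x, hx, rfl⟩
      simp [hx]
    · intro hi
      refine ⟨f.symm ⟨i, hi⟩, (f.symm ⟨i, hi⟩).2, ?_⟩
      simp

/-- Partial bijections of a finite set extend to permutations in a coherent way. -/
theorem exists_coherent_extension (N : Type*) [Finite N] :
    ∃ E : SetRel N N → Perm N,
      (∀ R, IsPartialBij R → ∀ x y, (x, y) ∈ R → E R x = y) ∧
      ∀ R S, IsPartialBij R → IsPartialBij S → R.cod = S.dom → E (R.comp S) = E S * E R := by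
  classical
  choose e he he' using fun X : Set N => exists_enumeration X
  -- Off the domain, the complements of domain and codomain are matched by rank. This part depends
  -- only on the two sets, so it composes when the codomain of one map is the domain of the next.
  let Φ : SetRel N N → N → N → Prop := fun R x y =>
    (x, y) ∈ R ∨ (x ∉ R.dom ∧ y ∉ R.cod ∧ e R.domᶜ x = e R.codᶜ y)
  have ex : ∀ R, IsPartialBij R → ∀ x, ∃ y, Φ R x y := by
    intro R hR x
    by_cases hx : x ∈ R.dom
    · obtain ⟨y, hy⟩ := hx
      exact ⟨y, Or.inl hy⟩
    · have h : e R.domᶜ x ∈ Set.Iio (R.codᶜ).ncard := by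
        rw [Set.ncard_compl, ← hR.ncard_dom_eq, ← Set.ncard_compl, ← he']
        exact ⟨x, hx, rfl⟩
      rw [← he'] at h
      obtain ⟨y, hy, hxy⟩ := h
      exact ⟨y, Or.inr ⟨hx, hy, hxy.symm⟩⟩
  have inj : ∀ R, IsPartialBij R → ∀ x x' y, Φ R x y → Φ R x' y → x = x' := by
    rintro R hR x x' y (h | ⟨hx, hy, h⟩) (h' | ⟨hx', hy', h'⟩)
    · exact (hR _ _ _ _ h h').2 rfl
    · exact absurd ⟨x, h⟩ hy'
    · exact absurd ⟨x', h'⟩ hy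
    · exact he _ hx hx' (h.trans h'.symm)
  have fn : ∀ R, IsPartialBij R → ∀ x y y', Φ R x y → Φ R x y' → y = y' := by
    rintro R hR x y y' (h | ⟨hx, hy, h⟩) (h' | ⟨hx', hy', h'⟩)
    · exact (hR _ _ _ _ h h').1 rfl
    · exact absurd ⟨y, h⟩ hx'
    · exact absurd ⟨y', h'⟩ hx
    · exact he _ hy hy' (h.symm.trans h')
  have key : ∀ R, ∃ σ : Perm N, IsPartialBij R → ∀ x, Φ R x (σ x) := by
    intro R
    by_cases hR : IsPartialBij R
    · choose f hf using ex R hR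
      refine ⟨Equiv.ofBijective f (Finite.injective_iff_bijective.1 fun x x' h => ?_),
        fun _ => hf⟩
      exact inj R hR x x' _ (hf x) (h ▸ hf x')
    · exact ⟨1, fun h => absurd h hR⟩
  choose E hE using key
  refine ⟨E, fun R hR x y hxy => fn R hR x _ _ (hE R hR x) (Or.inl hxy), ?_⟩
  intro R S hR hS h
  have hRS : IsPartialBij (R.comp S) := by
    rintro x z x' z' ⟨y, hxy, hyz⟩ ⟨y', hxy', hyz'⟩
    exact (hR _ _ _ _ hxy hxy').trans (hS _ _ _ _ hyz hyz')
  ext x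
  refine fn _ hRS x _ _ (hE _ hRS x) ?_
  have h2 := hE S hS (E R x)
  rcases hE R hR x with h1 | ⟨hx, hy, h1⟩
  · rcases h2 with h2 | ⟨hy', -, -⟩
    · exact Or.inl ⟨_, h1, h2⟩
    · exact absurd ⟨x, h1⟩ (h ▸ hy')
  · rcases h2 with h2 | ⟨-, hz, h2⟩
    · exact absurd ⟨_, h2⟩ (h ▸ hy)
    · refine Or.inr ⟨?_, ?_, ?_⟩
      · rwa [dom_comp_of_cod_eq h]
      · rwa [cod_comp_of_cod_eq h]
      · rw [dom_comp_of_cod_eq h, cod_comp_of_cod_eq h, h1, h, h2]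
        rfl

/-- The version of `exists_coherent_extension` for initial segments of `ℕ`. -/
theorem exists_coherent_extension_nat :
    ∃ E : ℕ → SetRel ℕ ℕ → Perm ℕ,
      (∀ n R i, i < n ↔ E n R i < n) ∧
      (∀ n R, IsPartialBij R → ∀ i j, i < n → j < n → (i, j) ∈ R → E n R i = j) ∧
      ∀ n R S, IsPartialBij R → IsPartialBij S → (∀ i j, (i, j) ∈ R → i < n ∧ j < n) →
        (∀ i j, (i, j) ∈ S → i < n ∧ j < n) → R.cod = S.dom → E n (R.comp S) = E n S * E n R := by
  choose E hE hE' using fun n : ℕ => exists_coherent_extension {i : ℕ // i < n}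
  let r : ∀ n, SetRel ℕ ℕ → SetRel {i : ℕ // i < n} {i : ℕ // i < n} := fun n R =>
    {q | ((q.1 : ℕ), (q.2 : ℕ)) ∈ R}
  have hr : ∀ n R, IsPartialBij R → IsPartialBij (r n R) := by
    intro n R hR x y x' y' h h'
    rw [Subtype.ext_iff, Subtype.ext_iff]
    exact hR _ _ _ _ h h'
  refine ⟨fun n R => Perm.ofSubtype (E n (r n R)), ?_, ?_, ?_⟩
  · intro n R i
    exact (Perm.ofSubtype_apply_mem_iff_mem (p := fun i => i < n) _ i).symm
  · intro n R hR i j hi hj hij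
    change Perm.ofSubtype _ _ = _
    rw [Perm.ofSubtype_apply_of_mem (p := fun i => i < n) _ hi, hE n (r n R) (hr n R hR) ⟨i, hi⟩ ⟨j, hj⟩ hij]
  · intro n R S hR hS hn hn' h
    have e : r n (R.comp S) = (r n R).comp (r n S) := by
      ext ⟨x, z⟩
      constructor
      · rintro ⟨y, hxy, hyz⟩
        exact ⟨⟨y, (hn _ _ hxy).2⟩, hxy, hyz⟩
      · rintro ⟨y, hxy, hyz⟩
        exact ⟨y, hxy, hyz⟩
    change Perm.ofSubtype _ = Perm.ofSubtype _ * Perm.ofSubtype _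
    rw [e, hE' n _ _ (hr n R hR) (hr n S hS), map_mul]
    ext y
    constructor
    · rintro ⟨x, hx⟩
      obtain ⟨z, hz⟩ : (y : ℕ) ∈ S.dom := h ▸ ⟨_, hx⟩
      exact ⟨⟨z, (hn' _ _ hz).2⟩, hz⟩
    · rintro ⟨z, hz⟩
      obtain ⟨x, hx⟩ : (y : ℕ) ∈ R.cod := h ▸ ⟨_, hz⟩
      exact ⟨⟨x, (hn _ _ hx).1⟩, hx⟩

/-- The group `H` of permutations of `V`, labelled by elements of `G`, extends all admissible
labelled partial bijections of `A` (placed in `V` by `ι`) coherently. -/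
def HasCoherentExtension {G A V : Type*} [Group G] (H : Subgroup (G × Perm V)) (ι : A → V)
    (Adm : G → SetRel A A → Prop) : Prop :=
  ∃ E : G → SetRel A A → Perm V,
    (∀ g R, Adm g R → (g, E g R) ∈ H ∧ ∀ x y, (x, y) ∈ R → E g R (ι x) = ι y) ∧
    ∀ g R g' R', Adm g R → Adm g' R' → R.cod = R'.dom →
      E (g' * g) (R.comp R') = E g' R' * E g R

/-! ### The affine cover: group elements preserve local structure -/

section Parity

variable {G : Type*} {A : Type u} {J : Type v} [Group G] [MulAction (G × Perm A) J]

/-- The labelled permutations of `A × (J → Z)` which are affine in the second coordinate, with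
translation parts which sum to zero over supports. -/
def affineGroup (Z : Type) [AddCommGroup Z] (supp : J → Finset A)
    (hsupp : ∀ (p : G × Perm A) j, supp (p • j) = (supp j).map p.2.toEmbedding) :
    Subgroup (G × Perm (A × (J → Z))) where
  carrier := {h | ∃ (σ : Perm A) (c : J → A → Z), (∀ j, ∑ y ∈ supp j, c j y = 0) ∧
    ∀ v, h.2 v = (σ v.1, fun j => v.2 ((h.1, σ)⁻¹ • j) + c j (σ v.1))}
  one_mem' := ⟨1, 0, by simp, fun v => by ext <;> simp [← Prod.one_eq_mk]⟩
  mul_mem' := by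
    rintro h h' ⟨σ, c, hc, hh⟩ ⟨σ', c', hc', hh'⟩
    refine ⟨σ * σ', fun j y => c' ((h.1, σ)⁻¹ • j) (σ⁻¹ y) + c j y, fun j => ?_, fun v => ?_⟩
    · have e : supp j = (supp ((h.1, σ)⁻¹ • j)).map σ.toEmbedding := by
        rw [← hsupp (h.1, σ), smul_inv_smul]
      rw [Finset.sum_add_distrib, hc, e, Finset.sum_map]
      simp [hc']
    · have e : ((h * h').1, σ * σ')⁻¹ = (h'.1, σ')⁻¹ * (h.1, σ)⁻¹ := by
        rw [← mul_inv_rev]; rfl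
      rw [e]
      simp [hh, hh', mul_smul, add_assoc, -Prod.inv_mk, -mul_inv_rev]
  inv_mem' := by
    rintro h ⟨σ, c, hc, hh⟩
    refine ⟨σ⁻¹, fun j x => - c ((h.1, σ) • j) (σ x), fun j => ?_, fun v => ?_⟩
    · have e := hc ((h.1, σ) • j)
      rw [hsupp, Finset.sum_map] at e
      rw [Finset.sum_neg_distrib, neg_eq_zero]
      exact e
    · have e : ((h⁻¹).1, σ⁻¹)⁻¹ = (h.1, σ) := inv_inv (h.1, σ)
      rw [e]
      change (h.2)⁻¹ v = _
      rw [Equiv.Perm.inv_eq_iff_eq, hh]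
      ext <;> simp [-Prod.inv_mk]

/-- The base is the graph of the constant map with value the indicator `γ` of `good`. An element of
the group that keeps the support of `j` in the base must translate by `γ (p • j) - γ j` at each
point of the support of `p • j`; since the translations sum to zero there, the difference vanishes.
An extension of a partial map may still change `γ` when the support leaves the domain, because the
surplus can be balanced on the remaining points. -/
theorem exists_parity_cover [Finite A] [Finite J] (supp : J → Finset A)
    (hsupp : ∀ (p : G × Perm A) j, supp (p • j) = (supp j).map p.2.toEmbedding)
    (good : J → Prop) (Adm : G → SetRel A A → Prop)
    (hAdm : ∀ g R, Adm g R → IsPartialBij R)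
    (hgood : ∀ g R, Adm g R → ∀ σ : Perm A, (∀ x y, (x, y) ∈ R → σ x = y) →
      ∀ j, ↑(supp j) ⊆ R.dom → (good ((g, σ) • j) ↔ good j)) :
    ∃ (V : Type (max u v)) (_ : Finite V) (H : Subgroup (G × Perm V)) (ι : A → V),
      Function.Injective ι ∧ HasCoherentExtension H ι Adm ∧
      ∀ h ∈ H, ∃ σ : Perm A, (∀ a b, h.2 (ι a) = ι b → σ a = b) ∧
        ∀ j, (supp j).Nonempty → (∀ a ∈ supp j, h.2 (ι a) ∈ Set.range ι) →
          (good ((h.1, σ) • j) ↔ good j) := by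
  classical
  have := Fintype.ofFinite A
  -- With `p > |A|`, the size of a nonempty subset of `A` is invertible modulo `p`.
  obtain ⟨p, hp, hprime⟩ := Nat.exists_infinite_primes (Fintype.card A + 1)
  have := Fact.mk hprime
  have cast_ne : ∀ s : Finset A, s.Nonempty → (s.card : ZMod p) ≠ 0 := by
    intro s hs h
    rw [ZMod.natCast_eq_zero_iff] at h
    have := Nat.le_of_dvd (Finset.card_pos.2 hs) h
    have := Finset.card_le_univ s
    omega
  let γ : J → ZMod p := fun j => if good j then 1 else 0
  have hγ : ∀ i j, γ i = γ j ↔ (good i ↔ good j) := by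
    intro i j
    by_cases hi : good i <;> by_cases hj : good j <;> simp [γ, hi, hj]
  refine ⟨A × (J → ZMod p), inferInstance, affineGroup (ZMod p) supp hsupp,
    fun a => (a, γ), fun a b h => congrArg Prod.fst h, ?_, ?_⟩
  · obtain ⟨E, hE, hE'⟩ := exists_coherent_extension A
    -- Weight `1` on the codomain is forced by sending base points to base points; the constant
    -- weight elsewhere makes the sum over `s` zero.
    let w : Finset A → SetRel A A → A → ZMod p := fun s R y =>
      if y ∈ R.cod then 1 else
        -((s.filter (· ∈ R.cod)).card : ZMod p) / ((s.filter (· ∉ R.cod)).card : ZMod p)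
    have hw : ∀ s R, ¬ (↑s ⊆ R.cod) → ∑ y ∈ s, w s R y = 0 := by
      intro s R hs
      have hne : (s.filter (· ∉ R.cod)).Nonempty := by
        obtain ⟨y, hy, hy'⟩ := Set.not_subset.1 hs
        exact ⟨y, Finset.mem_filter.2 ⟨hy, hy'⟩⟩
      rw [← Finset.sum_filter_add_sum_filter_not s (· ∈ R.cod)]
      have e1 : ∑ y ∈ s.filter (· ∈ R.cod), w s R y = (s.filter (· ∈ R.cod)).card := by
        rw [Finset.sum_congr rfl (g := fun _ => (1 : ZMod p))]
        · simp
        · intro y hy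
          simp only [w, (Finset.mem_filter.1 hy).2, if_true]
      have e2 : ∑ y ∈ s.filter (· ∉ R.cod), w s R y = -(s.filter (· ∈ R.cod)).card := by
        rw [Finset.sum_congr rfl (g := fun _ => -((s.filter (· ∈ R.cod)).card : ZMod p) /
          ((s.filter (· ∉ R.cod)).card : ZMod p))]
        · rw [Finset.sum_const, nsmul_eq_mul, mul_div_cancel₀ _ (cast_ne _ hne)]
        · intro y hy
          simp only [w, (Finset.mem_filter.1 hy).2, if_false]
      rw [e1, e2, add_neg_cancel]
    let c : G → SetRel A A → J → A → ZMod p := fun g R j y =>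
      (γ j - γ ((g, E R)⁻¹ • j)) * w (supp j) R y
    let f : G → SetRel A A → A × (J → ZMod p) → A × (J → ZMod p) := fun g R v =>
      (E R v.1, fun j => v.2 ((g, E R)⁻¹ • j) + c g R j (E R v.1))
    have hf : ∀ g R, Function.Injective (f g R) := by
      rintro g R ⟨x, χ⟩ ⟨x', χ'⟩ h
      obtain ⟨h1, h2⟩ := Prod.ext_iff.1 h
      have h1 : x = x' := (E R).injective h1
      subst h1
      refine Prod.ext rfl (funext fun j => ?_)
      have := congrFun h2 ((g, E R) • j)
      simpa [f, -Prod.inv_mk] using this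
    refine ⟨fun g R => Equiv.ofBijective (f g R) (Finite.injective_iff_bijective.1 (hf g R)),
      fun g R hR => ⟨⟨E R, c g R, fun j => ?_, fun v => rfl⟩, fun x y hxy => ?_⟩, ?_⟩
    · rw [← Finset.mul_sum]
      -- If no point of the support is free for balancing, `R` determines the map on the whole
      -- support and `hgood` makes the factor in front zero.
      by_cases hs : ↑(supp j) ⊆ R.cod
      · have hs' : ↑(supp ((g, E R)⁻¹ • j)) ⊆ R.dom := by
          intro x hx
          have hx' : E R x ∈ supp j := by
            rw [← smul_inv_smul (g, E R) j, hsupp]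
            exact Finset.mem_map_of_mem _ hx
          obtain ⟨x', hx''⟩ := hs hx'
          have := (E R).injective (hE R (hAdm g R hR) _ _ hx'')
          exact ⟨E R x, this ▸ hx''⟩
        have := hgood g R hR (E R) (hE R (hAdm g R hR)) _ hs'
        rw [smul_inv_smul, ← hγ] at this
        rw [this, sub_self, zero_mul]
      · rw [hw _ _ hs, mul_zero]
    · have e := hE R (hAdm g R hR) x y hxy
      have hy : y ∈ R.cod := ⟨x, hxy⟩
      change f g R _ = _
      simp only [f, c, e, w, hy, if_true]
      ext <;> simp
    · intro g R g' R' hR hR' hcod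
      ext1 v
      change f (g' * g) (R.comp R') v = f g' R' (f g R v)
      have e := hE' R R' (hAdm _ _ hR) (hAdm _ _ hR') hcod
      have e' : (g' * g, E (R.comp R'))⁻¹ = (g, E R)⁻¹ * (g', E R')⁻¹ := by
        rw [e, ← mul_inv_rev]; rfl
      have mem : ∀ y, E R' y ∈ R'.cod ↔ y ∈ R.cod := by
        intro y
        rw [hcod]
        constructor
        · rintro ⟨x, hx⟩
          have := (E R').injective (hE R' (hAdm _ _ hR') _ _ hx)
          exact ⟨E R' y, this ▸ hx⟩
        · rintro ⟨z, hz⟩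
          exact ⟨y, (hE R' (hAdm _ _ hR') _ _ hz).symm ▸ hz⟩
      -- The weights depend only on the support and the codomain, so both factors of a composition
      -- use the same weight and the differences of `γ` telescope.
      have hww : ∀ j y, w (supp ((g', E R')⁻¹ • j)) R y = w (supp j) R' (E R' y) := by
        intro j y
        have es : supp j = (supp ((g', E R')⁻¹ • j)).map (E R').toEmbedding := by
          rw [← hsupp (g', E R'), smul_inv_smul]
        simp only [w, es, Finset.filter_map, Finset.card_map, Function.comp_def,
          Equiv.coe_toEmbedding, mem]
      have hcc : ∀ s y, w s (R.comp R') y = w s R' y := by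
        intro s y
        simp only [w, cod_comp_of_cod_eq hcod]
      rw [e] at e'
      refine Prod.ext ?_ (funext fun j => ?_)
      · simp [f, e]
      · simp only [f, c, e, e', mul_smul, hww, hcc, Perm.mul_apply]
        ring
  · rintro h ⟨σ, c, hc, hh⟩
    refine ⟨σ, fun a b hab => ?_, fun j hj hrange => ?_⟩
    · rw [hh] at hab
      exact congrArg Prod.fst hab
    · have e : ∀ y ∈ supp ((h.1, σ) • j), c ((h.1, σ) • j) y = γ ((h.1, σ) • j) - γ j := by
        intro y hy
        rw [hsupp] at hy
        obtain ⟨a, ha, rfl⟩ := Finset.mem_map.1 hy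
        obtain ⟨b, hb⟩ := hrange a ha
        rw [hh] at hb
        have := congrFun (congrArg Prod.snd hb) ((h.1, σ) • j)
        simp only [inv_smul_smul] at this
        rw [this]
        simp
      have hs := hc ((h.1, σ) • j)
      rw [Finset.sum_congr rfl e, Finset.sum_const, nsmul_eq_mul, mul_eq_zero] at hs
      rw [← hγ]
      refine sub_eq_zero.1 (hs.resolve_left (cast_ne _ ?_))
      rw [hsupp]
      simpa using hj

end Parity

/-! ### The conformal cover: pairwise containment in translates suffices -/

section Conformal

variable {G : Type*} {A : Type*} {V : Type u} [Group G]

/-- A set of vertices is bad if no element of `H` moves it into the range of `ι`. -/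
def IsBad (H : Subgroup (G × Perm V)) (ι : A → V) (M : Set V) : Prop :=
  ∀ h ∈ H, ¬ h.2 '' M ⊆ Set.range ι

theorem IsBad.preimage {H : Subgroup (G × Perm V)} {ι : A → V} {M : Set V} (hM : IsBad H ι M)
    {g : G} {τ : Perm V} (h : (g, τ) ∈ H) : IsBad H ι (τ ⁻¹' M) := by
  intro k hk hs
  refine hM (k * (g, τ)⁻¹) (H.mul_mem hk (H.inv_mem h)) ?_
  rintro _ ⟨v, hv, rfl⟩
  exact hs ⟨τ⁻¹ v, by simpa using hv, rfl⟩

theorem IsBad.preimage_symm {H : Subgroup (G × Perm V)} {ι : A → V} {M : Set V}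
    (hM : IsBad H ι M) {g : G} {τ : Perm V} (h : (g, τ) ∈ H) : IsBad H ι (τ.symm ⁻¹' M) :=
  hM.preimage (H.inv_mem h)

/-- Vertices with a valuation, which assigns to each bad set `M` containing the vertex one of
`|M| - 1` values. -/
def Valued (H : Subgroup (G × Perm V)) (ι : A → V) : Type u :=
  {v : V × (Set V → ℕ) // ∀ M, (IsBad H ι M ∧ v.1 ∈ M → v.2 M + 1 < M.ncard) ∧
    (¬ (IsBad H ι M ∧ v.1 ∈ M) → v.2 M = 0)}

theorem Valued.ext {H : Subgroup (G × Perm V)} {ι : A → V} {u w : Valued H ι}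
    (h : u.1.1 = w.1.1) (h' : ∀ M, IsBad H ι M → w.1.1 ∈ M → u.1.2 M = w.1.2 M) : u = w := by
  refine Subtype.ext (Prod.ext h (funext fun M => ?_))
  by_cases hM : IsBad H ι M ∧ w.1.1 ∈ M
  · exact h' M hM.1 hM.2
  · rw [(w.2 M).2 hM, (u.2 M).2 (by rwa [h])]

instance [Finite V] (H : Subgroup (G × Perm V)) (ι : A → V) : Finite (Valued H ι) := by
  have hb : ∀ (u : Valued H ι) M, u.1.2 M < Nat.card V + 1 := by
    intro u M
    by_cases hM : IsBad H ι M ∧ u.1.1 ∈ M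
    · have h1 := (u.2 M).1 hM
      have h2 := Set.ncard_le_card M
      omega
    · rw [(u.2 M).2 hM]
      omega
  refine Finite.of_injective
    (fun u : Valued H ι => (u.1.1, fun M => (⟨u.1.2 M, hb u M⟩ : Fin (Nat.card V + 1)))) ?_
  intro u w h
  obtain ⟨h1, h2⟩ := Prod.ext_iff.1 h
  refine Subtype.ext (Prod.ext h1 (funext fun M => ?_))
  exact congrArg Fin.val (congrFun h2 M)

/-- The labelled permutations of valued vertices which lie over elements of `H`, and permute the
values at each bad set. -/
def valuedGroup (H : Subgroup (G × Perm V)) (ι : A → V) : Subgroup (G × Perm (Valued H ι)) where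
  carrier := {h | ∃ (τ : Perm V) (e : Set V → Perm ℕ), (h.1, τ) ∈ H ∧ ∀ u,
    (h.2 u).1.1 = τ u.1.1 ∧
      ∀ M, IsBad H ι M → τ u.1.1 ∈ M → (h.2 u).1.2 M = e M (u.1.2 (τ ⁻¹' M))}
  one_mem' := ⟨1, fun _ => 1, H.one_mem, fun u => ⟨rfl, fun M _ _ => rfl⟩⟩
  mul_mem' := by
    rintro h h' ⟨τ, e, hτ, he⟩ ⟨τ', e', hτ', he'⟩
    refine ⟨τ * τ', fun M => e M * e' (τ ⁻¹' M), H.mul_mem hτ hτ', fun u => ⟨?_, ?_⟩⟩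
    · change (h.2 (h'.2 u)).1.1 = τ (τ' u.1.1)
      rw [(he _).1, (he' _).1]
    · intro M hM hu
      change (h.2 (h'.2 u)).1.2 M = e M (e' (τ ⁻¹' M) (u.1.2 (τ' ⁻¹' (τ ⁻¹' M))))
      rw [(he _).2 M hM (by rw [(he' _).1]; exact hu), (he' _).2 _ (hM.preimage hτ) hu]
  inv_mem' := by
    rintro h ⟨τ, e, hτ, he⟩
    have h1 : ∀ u, τ.symm u.1.1 = (h.2.symm u).1.1 := by
      intro u
      rw [Equiv.symm_apply_eq, ← (he _).1, Equiv.apply_symm_apply]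
    refine ⟨τ⁻¹, fun M => (e (τ.symm ⁻¹' M))⁻¹, H.inv_mem hτ, fun u => ⟨(h1 u).symm, ?_⟩⟩
    intro M hM hu
    have h2 := (he (h.2.symm u)).2 (τ.symm ⁻¹' M) (hM.preimage_symm hτ)
      (by rw [← (he _).1, Equiv.apply_symm_apply]; exact hu)
    rw [Equiv.apply_symm_apply, Equiv.preimage_symm_preimage] at h2
    exact ((Equiv.symm_apply_eq _).2 h2).symm

/-- The lift is a function of `τ` and `e` alone, which makes lifts of equal data equal; inputs that
do not satisfy the conditions get the identity. An injective self-map of the finite set of valued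
vertices is a permutation. -/
theorem exists_valued_lift [Finite V] (H : Subgroup (G × Perm V)) (ι : A → V) :
    ∃ T : Perm V → (Set V → Perm ℕ) → Perm (Valued H ι), ∀ g τ e, (g, τ) ∈ H →
      (∀ M i, i + 1 < M.ncard → e M i + 1 < M.ncard) → ∀ u,
        (T τ e u).1.1 = τ u.1.1 ∧
          ∀ M, IsBad H ι M → τ u.1.1 ∈ M → (T τ e u).1.2 M = e M (u.1.2 (τ ⁻¹' M)) := by
  classical
  have key : ∀ (τ : Perm V) (e : Set V → Perm ℕ), ∃ T : Perm (Valued H ι), ∀ g, (g, τ) ∈ H →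
      (∀ M i, i + 1 < M.ncard → e M i + 1 < M.ncard) → ∀ u,
        (T u).1.1 = τ u.1.1 ∧
          ∀ M, IsBad H ι M → τ u.1.1 ∈ M → (T u).1.2 M = e M (u.1.2 (τ ⁻¹' M)) := by
    intro τ e
    by_cases hτ : ∃ g, (g, τ) ∈ H
    swap
    · exact ⟨1, fun g hg => absurd ⟨g, hg⟩ hτ⟩
    obtain ⟨g, hg⟩ := hτ
    by_cases he : ∀ M i, i + 1 < M.ncard → e M i + 1 < M.ncard
    swap
    · exact ⟨1, fun _ _ h => absurd h he⟩
    let f : Valued H ι → Valued H ι := fun u =>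
      ⟨(τ u.1.1, fun M => if IsBad H ι M ∧ τ u.1.1 ∈ M then e M (u.1.2 (τ ⁻¹' M)) else 0), by
        intro M
        refine ⟨fun h => ?_, fun h => if_neg h⟩
        simp only [h, and_self, if_true]
        apply he
        have := (u.2 (τ ⁻¹' M)).1 ⟨h.1.preimage hg, h.2⟩
        rwa [Set.ncard_preimage_of_injective_subset_range τ.injective
          (by simp [τ.surjective.range_eq])] at this⟩
    have hf : Function.Injective f := by
      intro u w h
      have h1 : u.1.1 = w.1.1 := τ.injective (congrArg (fun v => v.1.1) h)
      refine Valued.ext h1 fun M hM hw => ?_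
      have hpre : τ ⁻¹' (τ.symm ⁻¹' M) = M := τ.preimage_symm_preimage M
      have hM' : IsBad H ι (τ.symm ⁻¹' M) := hM.preimage_symm hg
      have h2 := congrArg (fun v => v.1.2 (τ.symm ⁻¹' M)) h
      simp only [f, h1] at h2
      rw [if_pos ⟨hM', by simpa using hw⟩, if_pos ⟨hM', by simpa using hw⟩, hpre] at h2
      exact (e _).injective h2
    refine ⟨Equiv.ofBijective f (Finite.injective_iff_bijective.1 hf), fun _ _ _ u => ⟨rfl, ?_⟩⟩
    intro M hM hu
    exact if_pos ⟨hM, hu⟩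
  choose T hT using key
  exact ⟨T, fun g τ e => hT τ e g⟩

/-- Every finite cover has a conformal cover: sets which are pairwise contained in translates of
the base are contained in a translate of the base. -/
theorem exists_conformal_cover [Finite V] (H : Subgroup (G × Perm V)) (ι : A → V)
    (hι : Function.Injective ι) (Adm : G → SetRel A A → Prop)
    (hAdm : ∀ g R, Adm g R → IsPartialBij R) (hExt : HasCoherentExtension H ι Adm) :
    ∃ (V' : Type u) (_ : Finite V') (H' : Subgroup (G × Perm V')) (ι' : A → V') (π : V' → V),
      Function.Injective ι' ∧ HasCoherentExtension H' ι' Adm ∧ (∀ a, π (ι' a) = ι a) ∧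
      (∀ h ∈ H', ∃ τ, (h.1, τ) ∈ H ∧ ∀ v, π (h.2 v) = τ (π v)) ∧
      ∀ S : Set V', (∀ u ∈ S, ∀ v ∈ S, ∃ h ∈ H', h.2 u ∈ Set.range ι' ∧ h.2 v ∈ Set.range ι') →
        ∃ h ∈ H', ∀ u ∈ S, h.2 u ∈ Set.range ι' := by
  classical
  obtain ⟨T, hT⟩ := exists_valued_lift H ι
  obtain ⟨E, hE, hE'⟩ := hExt
  obtain ⟨F, hFlt, hF, hF'⟩ := exists_coherent_extension_nat
  choose rk hrk hrk' using fun M : Set V => exists_enumeration (Set.range ι ∩ M)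
  -- A bad set is not contained in the base, so its base vertices have ranks at most `|M| - 2` and
  -- fit into the `|M| - 1` available values.
  have hlt : ∀ M a, IsBad H ι M → ι a ∈ M → rk M (ι a) + 1 < M.ncard := by
    intro M a hM ha
    have h1 : rk M (ι a) ∈ Set.Iio (Set.range ι ∩ M).ncard := by
      rw [← hrk']
      exact ⟨ι a, ⟨⟨a, rfl⟩, ha⟩, rfl⟩
    have h2 : (Set.range ι ∩ M).ncard < M.ncard := by
      refine Set.ncard_lt_ncard ⟨Set.inter_subset_right, fun hs => ?_⟩ (Set.toFinite _)
      refine hM 1 H.one_mem ?_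
      rintro _ ⟨v, hv, rfl⟩
      exact (hs hv).1
    have h1 : rk M (ι a) < (Set.range ι ∩ M).ncard := h1
    omega
  let ι' : A → Valued H ι := fun a =>
    ⟨(ι a, fun M => if IsBad H ι M ∧ ι a ∈ M then rk M (ι a) else 0), fun M =>
      ⟨fun h => by simpa only [h, and_self, if_true] using hlt M a h.1 h.2, fun h => if_neg h⟩⟩
  have hval : ∀ M a b, IsBad H ι M → ι a ∈ M → ι b ∈ M → ((ι' a).1.2 M = (ι' b).1.2 M ↔ a = b) := by
    intro M a b hM ha hb
    refine ⟨fun h => ?_, fun h => h ▸ rfl⟩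
    simp only [ι', hM, ha, hb, and_self, if_true] at h
    exact hι (hrk M ⟨⟨a, rfl⟩, ha⟩ ⟨⟨b, rfl⟩, hb⟩ h)
  -- the permutations of values induced by a partial map of valued vertices
  let rel : SetRel (Valued H ι) (Valued H ι) → Perm V → Set V → SetRel ℕ ℕ := fun Q τ M =>
    {q | ∃ u w, (u, w) ∈ Q ∧ w.1.1 ∈ M ∧ u.1.2 (τ ⁻¹' M) = q.1 ∧ w.1.2 M = q.2}
  let perms : SetRel (Valued H ι) (Valued H ι) → Perm V → Set V → Perm ℕ := fun Q τ M =>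
    if IsBad H ι M then F (M.ncard - 1) (rel Q τ M) else 1
  have hperms : ∀ Q τ M i, i + 1 < M.ncard → perms Q τ M i + 1 < M.ncard := by
    intro Q τ M i hi
    by_cases hM : IsBad H ι M
    · simp only [perms, hM, if_true]
      have := (hFlt (M.ncard - 1) (rel Q τ M) i).1 (by omega)
      omega
    · simpa only [perms, hM, if_false, Perm.one_apply] using hi
  have hncard : ∀ (τ : Perm V) (M : Set V), (τ ⁻¹' M).ncard = M.ncard := fun τ M =>
    Set.ncard_preimage_of_injective_subset_range τ.injective (by simp [τ.surjective.range_eq])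
  -- Under this condition the values at each bad set are matched by a partial bijection, which
  -- extends to a permutation of the values; hence `Q` extends to an element of the group over `τ`.
  let Compatible : SetRel (Valued H ι) (Valued H ι) → Perm V → Prop := fun Q τ =>
    (∀ u w, (u, w) ∈ Q → w.1.1 = τ u.1.1) ∧
    ∀ u w u' w', (u, w) ∈ Q → (u', w') ∈ Q → ∀ M, IsBad H ι M → w.1.1 ∈ M → w'.1.1 ∈ M →
      (u.1.2 (τ ⁻¹' M) = u'.1.2 (τ ⁻¹' M) ↔ w.1.2 M = w'.1.2 M)
  have hbij : ∀ Q τ, Compatible Q τ → ∀ M, IsBad H ι M → IsPartialBij (rel Q τ M) := by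
    rintro Q τ hQ M hM _ _ _ _ ⟨u, w, huw, hw, rfl, rfl⟩ ⟨u', w', huw', hw', rfl, rfl⟩
    exact hQ.2 _ _ _ _ huw huw' M hM hw hw'
  have hbound : ∀ g Q τ, (g, τ) ∈ H → Compatible Q τ → ∀ M, IsBad H ι M → ∀ i j,
      (i, j) ∈ rel Q τ M → i < M.ncard - 1 ∧ j < M.ncard - 1 := by
    rintro g Q τ hg hQ M hM _ _ ⟨u, w, huw, hw, rfl, rfl⟩
    have h1 := (w.2 M).1 ⟨hM, hw⟩
    have h2 := (u.2 (τ ⁻¹' M)).1 ⟨hM.preimage hg, by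
      change τ u.1.1 ∈ M
      rwa [← hQ.1 u w huw]⟩
    rw [hncard] at h2
    omega
  have hextend : ∀ g Q τ, (g, τ) ∈ H → Compatible Q τ →
      (g, T τ (perms Q τ)) ∈ valuedGroup H ι ∧ ∀ u w, (u, w) ∈ Q → T τ (perms Q τ) u = w := by
    intro g Q τ hg hQ
    have hTe := hT g τ (perms Q τ) hg (hperms Q τ)
    refine ⟨⟨τ, perms Q τ, hg, hTe⟩, fun u w huw => ?_⟩
    have h1 : (T τ (perms Q τ) u).1.1 = w.1.1 := by rw [(hTe u).1, hQ.1 u w huw]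
    refine Valued.ext h1 fun M hM hw => ?_
    rw [(hTe u).2 M hM (by rwa [← hQ.1 u w huw])]
    simp only [perms, hM, if_true]
    have hmem : (u.1.2 (τ ⁻¹' M), w.1.2 M) ∈ rel Q τ M := ⟨u, w, huw, hw, rfl, rfl⟩
    have hb := hbound g Q τ hg hQ M hM _ _ hmem
    exact hF _ _ (hbij Q τ hQ M hM) _ _ hb.1 hb.2 hmem
  let Q : SetRel A A → SetRel (Valued H ι) (Valued H ι) := fun R =>
    {q | ∃ a b, (a, b) ∈ R ∧ q = (ι' a, ι' b)}
  have hQ : ∀ g R, Adm g R → Compatible (Q R) (E g R) := by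
    intro g R hR
    refine ⟨?_, ?_⟩
    · rintro _ _ ⟨a, b, hab, ⟨⟩⟩
      exact ((hE g R hR).2 a b hab).symm
    · rintro _ _ _ _ ⟨a, b, hab, ⟨⟩⟩ ⟨a', b', hab', ⟨⟩⟩ M hM hb hb'
      have ha : ι a ∈ E g R ⁻¹' M := by
        rw [Set.mem_preimage, (hE g R hR).2 a b hab]
        exact hb
      have ha' : ι a' ∈ E g R ⁻¹' M := by
        rw [Set.mem_preimage, (hE g R hR).2 a' b' hab']
        exact hb'
      rw [hval M b b' hM hb hb', hval _ a a' (hM.preimage (hE g R hR).1) ha ha']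
      exact hAdm g R hR _ _ _ _ hab hab'
  refine ⟨Valued H ι, inferInstance, valuedGroup H ι, ι', fun u => u.1.1, ?_, ?_, ?_, ?_, ?_⟩
  · intro a b h
    exact hι (congrArg (fun v => v.1.1) h)
  · refine ⟨fun g R => T (E g R) (perms (Q R) (E g R)), ?_, ?_⟩
    · intro g R hR
      have := hextend g (Q R) (E g R) (hE g R hR).1 (hQ g R hR)
      exact ⟨this.1, fun x y hxy => this.2 _ _ ⟨x, y, hxy, rfl⟩⟩
    · intro g R g' R' hR hR' hcod
      have hm := (hE g R hR).1
      have hm' := (hE g' R' hR').1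
      have hm'' : (g' * g, E (g' * g) (R.comp R')) ∈ H := by
        rw [hE' g R g' R' hR hR' hcod]
        exact H.mul_mem hm' hm
      have t := hT g _ _ hm (hperms (Q R) (E g R))
      have t' := hT g' _ _ hm' (hperms (Q R') (E g' R'))
      have t'' := hT (g' * g) _ _ hm'' (hperms (Q (R.comp R')) (E (g' * g) (R.comp R')))
      rw [hE' g R g' R' hR hR' hcod] at t''
      beta_reduce
      rw [hE' g R g' R' hR hR' hcod]
      ext1 u
      change _ = T _ _ (T _ _ u)
      refine Valued.ext ?_ fun M hM hu => ?_
      · rw [(t'' u).1, (t' _).1, (t u).1]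
        rfl
      · rw [(t' _).1, (t u).1] at hu
        rw [(t'' u).2 M hM hu, (t' _).2 M hM (by rwa [(t u).1]),
          (t u).2 _ (hM.preimage hm') hu]
        have hM' := hM.preimage hm'
        simp only [perms, hM, hM', if_true, hncard]
        -- Coherence of the lifts reduces to coherence of the value permutations: the induced
        -- partial maps of values compose with matching codomain and domain. Base vertices in a bad
        -- set are determined by their values, so the middle vertex is unique.
        have hrel : rel (Q (R.comp R')) (E g' R' * E g R) M =
            (rel (Q R) (E g R) (E g' R' ⁻¹' M)).comp (rel (Q R') (E g' R') M) := by
          ext ⟨i, k⟩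
          constructor
          · rintro ⟨_, _, ⟨a, c, ⟨b, hab, hbc⟩, ⟨⟩⟩, hc, hi, hk⟩
            have hb : ι b ∈ E g' R' ⁻¹' M := by
              rw [Set.mem_preimage, (hE g' R' hR').2 b c hbc]
              exact hc
            exact ⟨(ι' b).1.2 (E g' R' ⁻¹' M), ⟨_, _, ⟨a, b, hab, rfl⟩, hb, hi, rfl⟩,
              ⟨_, _, ⟨b, c, hbc, rfl⟩, hc, rfl, hk⟩⟩
          · rintro ⟨j, ⟨_, _, ⟨a, b, hab, ⟨⟩⟩, hb, hi, hj⟩, ⟨_, _, ⟨b', c, hbc, ⟨⟩⟩, hc, hj', hk⟩⟩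
            have hb' : ι b' ∈ E g' R' ⁻¹' M := by
              rw [Set.mem_preimage, (hE g' R' hR').2 b' c hbc]
              exact hc
            obtain rfl := (hval _ b b' hM' hb hb').1 (hj.trans hj'.symm)
            exact ⟨_, _, ⟨a, c, ⟨b, hab, hbc⟩, rfl⟩, hc, hi, hk⟩
        have hcod' : (rel (Q R) (E g R) (E g' R' ⁻¹' M)).cod = (rel (Q R') (E g' R') M).dom := by
          ext j
          constructor
          · rintro ⟨i, _, _, ⟨a, b, hab, ⟨⟩⟩, hb, hi, hj⟩
            obtain ⟨c, hbc⟩ : b ∈ R'.dom := hcod ▸ ⟨a, hab⟩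
            have hc : ι c ∈ M := by
              rw [← (hE g' R' hR').2 b c hbc]
              exact hb
            exact ⟨_, _, _, ⟨b, c, hbc, rfl⟩, hc, hj, rfl⟩
          · rintro ⟨k, _, _, ⟨b, c, hbc, ⟨⟩⟩, hc, hj, hk⟩
            obtain ⟨a, hab⟩ : b ∈ R.cod := hcod ▸ ⟨c, hbc⟩
            have hb : ι b ∈ E g' R' ⁻¹' M := by
              rw [Set.mem_preimage, (hE g' R' hR').2 b c hbc]
              exact hc
            exact ⟨_, _, _, ⟨a, b, hab, rfl⟩, hb, rfl, hj⟩
        have hb := hbound g (Q R) _ hm (hQ g R hR) _ hM'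
        rw [hncard] at hb
        rw [hrel, hF' _ _ _ (hbij _ _ (hQ g R hR) _ hM') (hbij _ _ (hQ g' R' hR') _ hM) hb
          (hbound g' (Q R') _ hm' (hQ g' R' hR') _ hM) hcod']
        rfl
  · intro a
    rfl
  · rintro h ⟨τ, e, hτ, he⟩
    exact ⟨τ, hτ, fun v => (he v).1⟩
  · intro S hS
    -- Distinct base vertices have distinct values at a bad set containing both, and the group
    -- preserves this; any two vertices of `S` lie in one translate.
    have hgen : ∀ u ∈ S, ∀ v ∈ S, ∀ M, IsBad H ι M → u.1.1 ∈ M → v.1.1 ∈ M →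
        u.1.2 M = v.1.2 M → u = v := by
      intro u hu v hv M hM huM hvM huv
      obtain ⟨h, ⟨τ, e, hτ, he⟩, ⟨a, ha⟩, ⟨b, hb⟩⟩ := hS u hu v hv
      have hM' : IsBad H ι (τ.symm ⁻¹' M) := hM.preimage_symm hτ
      have hpre : τ ⁻¹' (τ.symm ⁻¹' M) = M := τ.preimage_symm_preimage M
      have hu' : τ u.1.1 ∈ τ.symm ⁻¹' M := by simpa using huM
      have hv' : τ v.1.1 ∈ τ.symm ⁻¹' M := by simpa using hvM
      have e1 := (he u).2 _ hM' hu'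
      have e2 := (he v).2 _ hM' hv'
      rw [hpre] at e1 e2
      rw [← (he u).1, ← ha] at hu'
      rw [← (he v).1, ← hb] at hv'
      rw [huv, ← e2, ← ha, ← hb] at e1
      have hab := (hval _ a b hM' hu' hv').1 e1
      apply h.2.injective
      rw [← ha, ← hb, hab]
    have hinj : ∀ u ∈ S, ∀ v ∈ S, u.1.1 = v.1.1 → u = v := by
      intro u hu v hv huv
      refine Valued.ext huv fun M hM hvM => ?_
      obtain ⟨h, ⟨τ, e, hτ, he⟩, ⟨a, ha⟩, ⟨b, hb⟩⟩ := hS u hu v hv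
      have h1 : (h.2 u).1.1 = (h.2 v).1.1 := by rw [(he u).1, (he v).1, huv]
      rw [← ha, ← hb] at h1
      have hab : a = b := hι h1
      have : u = v := h.2.injective (by rw [← ha, ← hb, hab])
      rw [this]
    -- Pigeonhole: if the projection of `S` were a bad set `M`, the `|M|` vertices of `S` would need
    -- distinct values among `|M| - 1`. This leaves `S` empty, and the empty set is not bad.
    have hnot : ¬ IsBad H ι ((fun u : Valued H ι => u.1.1) '' S) := by
      intro hbad
      set M := (fun u : Valued H ι => u.1.1) '' S with hMdef
      have hcard : M.ncard = S.ncard :=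
        Set.InjOn.ncard_image fun u hu v hv h => hinj u hu v hv h
      have hmaps : (fun u : Valued H ι => u.1.2 M) '' S ⊆ Set.Iio (M.ncard - 1) := by
        rintro _ ⟨u, hu, rfl⟩
        have := (u.2 M).1 ⟨hbad, u, hu, rfl⟩
        change u.1.2 M < M.ncard - 1
        omega
      have h1 := Set.ncard_le_ncard hmaps (Set.finite_Iio _)
      rw [Set.InjOn.ncard_image fun u hu v hv h =>
        hgen u hu v hv M hbad ⟨u, hu, rfl⟩ ⟨v, hv, rfl⟩ h, Set.ncard_Iio_nat, hcard] at h1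
      have h0 : S.ncard = 0 := by omega
      rw [Set.ncard_eq_zero] at h0
      refine hbad 1 H.one_mem ?_
      rw [hMdef, h0]
      simp
    simp only [IsBad, not_forall, not_not] at hnot
    obtain ⟨⟨g, τ⟩, hτ, hsub⟩ := hnot
    -- The projection of `S` is moved into the base by `τ`. Since values separate vertices both in
    -- `S` and in the base, they can be permuted so that `S` itself lands in the base.
    let QS : SetRel (Valued H ι) (Valued H ι) :=
      {q | q.1 ∈ S ∧ ∃ a, q.2 = ι' a ∧ ι a = τ q.1.1.1}
    have hQS : Compatible QS τ := by
      refine ⟨?_, ?_⟩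
      · rintro u _ ⟨hu, a, rfl, ha⟩
        exact ha
      · rintro u _ u' _ ⟨hu, a, rfl, ha⟩ ⟨hu', a', rfl, ha'⟩ M hM haM haM'
        change u ∈ S at hu
        change u' ∈ S at hu'
        change ι a = τ u.1.1 at ha
        change ι a' = τ u'.1.1 at ha'
        change ι a ∈ M at haM
        change ι a' ∈ M at haM'
        rw [hval M a a' hM haM haM']
        constructor
        · intro h
          have := hgen u hu u' hu' _ (hM.preimage hτ) (by rwa [Set.mem_preimage, ← ha])
            (by rwa [Set.mem_preimage, ← ha']) h
          apply hι
          rw [ha, ha', this]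
        · rintro rfl
          have := hinj u hu u' hu' (τ.injective (ha.symm.trans ha'))
          rw [this]
    have := hextend g QS τ hτ hQS
    refine ⟨_, this.1, fun u hu => ?_⟩
    obtain ⟨a, ha⟩ := hsub ⟨u.1.1, ⟨u, hu, rfl⟩, rfl⟩
    exact ⟨a, (this.2 u (ι' a) ⟨hu, a, rfl, ha⟩).symm⟩

end Conformal

/-! ### Local types of a structure and the cover they define -/

section Relabel

variable {L : UnaryLanguage.{u, v}} {Γ : Subgroup L.Perm}

/-- The simultaneous action on the language and on the vertices. -/
instance labelledPermAction (Γ : Subgroup L.Perm) (V : Type w) :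
    MulAction (Γ × Perm V) (Interp L V) where
  smul p S :=
    { rel := fun n r => {x | p.2.symm ∘ x ∈ S.rel n ((p.1⁻¹).1.1 n r)}
      fn := fun F x => {y | p.2.symm y ∈ S.fn ((p.1⁻¹).1.2 F) (p.2.symm x)} }
  one_smul _ := rfl
  mul_smul g h S := by
    have e : (g * h).1⁻¹ = h.1⁻¹ * g.1⁻¹ := mul_inv_rev g.1 h.1
    change Interp.mk _ _ = Interp.mk _ _
    rw [e]
    rfl

theorem mem_smul_rel {V : Type w} (p : Γ × Perm V) (S : Interp L V) {n} (r : L.Rel n)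
    (x : Fin n → V) : p.2 ∘ x ∈ (p • S).rel n (p.1.1.1 n r) ↔ x ∈ S.rel n r := by
  change p.2.symm ∘ p.2 ∘ x ∈ S.rel n ((p.1.1.1 n).symm (p.1.1.1 n r)) ↔ _
  rw [← Function.comp_assoc, Equiv.symm_comp_self, Equiv.symm_apply_apply]
  rfl

theorem mem_smul_fn {V : Type w} (p : Γ × Perm V) (S : Interp L V) (F : L.Fn) (x y : V) :
    p.2 y ∈ (p • S).fn (p.1.1.2 F) (p.2 x) ↔ y ∈ S.fn F x := by
  change p.2.symm (p.2 y) ∈ S.fn ((p.1.1.2).symm (p.1.1.2 F)) (p.2.symm (p.2 x)) ↔ _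
  simp only [Equiv.symm_apply_apply]

theorem finite_orbit_labelledPerm {V : Type w} [Finite V] {S : Interp L V}
    (h : (MulAction.orbit Γ S).Finite) : (MulAction.orbit (Γ × Perm V) S).Finite := by
  refine (Set.Finite.image2 (fun (σ : Perm V) T => ((1, σ) : Γ × Perm V) • T)
    (Set.toFinite Set.univ) h).subset ?_
  rintro _ ⟨⟨g, σ⟩, rfl⟩
  refine ⟨σ, trivial, g • S, ⟨g, rfl⟩, ?_⟩
  have e : ((g, σ) : Γ × Perm V) = (1, σ) * (g, 1) := by simp
  change _ = (g, σ) • S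
  rw [e, mul_smul]
  rfl

/-- Two interpretations agree on tuples and vertices from `s`. -/
def Agree {V : Type w} (s : Set V) (S T : Interp L V) : Prop :=
  (∀ n (r : L.Rel n) (x : Fin n → V), (∀ i, x i ∈ s) → (x ∈ S.rel n r ↔ x ∈ T.rel n r)) ∧
    ∀ (F : L.Fn), ∀ x ∈ s, S.fn F x = T.fn F x

theorem Agree.symm {V : Type w} {s : Set V} {S T : Interp L V} (h : Agree s S T) : Agree s T S :=
  ⟨fun n r x hx => (h.1 n r x hx).symm, fun F x hx => (h.2 F x hx).symm⟩

theorem Agree.trans {V : Type w} {s : Set V} {S T U : Interp L V} (h : Agree s S T)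
    (h' : Agree s T U) : Agree s S U :=
  ⟨fun n r x hx => (h.1 n r x hx).trans (h'.1 n r x hx),
    fun F x hx => (h.2 F x hx).trans (h'.2 F x hx)⟩

theorem Agree.smul {V : Type w} {s : Set V} {S T : Interp L V} (h : Agree s S T)
    (p : Γ × Perm V) : Agree (p.2.symm ⁻¹' s) (p • S) (p • T) := by
  refine ⟨fun n r x hx => h.1 n _ _ hx, fun F x hx => ?_⟩
  change {y | _ ∈ S.fn _ _} = {y | _ ∈ T.fn _ _}
  rw [h.2 _ _ hx]

theorem agree_smul_iff {V : Type w} {s : Set V} {S T : Interp L V} (p : Γ × Perm V) :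
    Agree (p.2.symm ⁻¹' s) (p • S) (p • T) ↔ Agree s S T := by
  refine ⟨fun h => ?_, fun h => h.smul p⟩
  have := h.smul p⁻¹
  rw [inv_smul_smul, inv_smul_smul] at this
  change Agree (p.2 ⁻¹' (p.2.symm ⁻¹' s)) _ _ at this
  rwa [Equiv.preimage_symm_preimage] at this

/-- `R` is the graph of a partial automorphism of `A` with language part `g`. -/
structure IsPartialAutGraph (A : Struc.{u, v, w} L) (g : Γ) (R : SetRel A.V A.V) : Prop where
  bij : IsPartialBij R
  rel : ∀ n (r : L.Rel n) (x y : Fin n → A.V), (∀ i, (x i, y i) ∈ R) →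
    (x ∈ A.str.rel n r ↔ y ∈ A.str.rel n (g.1.1 n r))
  fn : ∀ (F : L.Fn) x y, (x, y) ∈ R → ∀ z ∈ A.str.fn F x, ∃ z' ∈ A.str.fn (g.1.2 F) y, (z, z') ∈ R
  fn' : ∀ (F : L.Fn) x y, (x, y) ∈ R → ∀ z' ∈ A.str.fn (g.1.2 F) y, ∃ z ∈ A.str.fn F x, (z, z') ∈ R

/-- The domain and range of `R` are closed under functions, so whole function values, even those
leaving `s`, are carried over by `σ`. -/
theorem IsPartialAutGraph.agree {A : Struc.{u, v, w} L} {g : Γ} {R : SetRel A.V A.V}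
    (h : IsPartialAutGraph A g R) {σ : Perm A.V} (hσ : ∀ x y, (x, y) ∈ R → σ x = y) {s : Set A.V}
    (hs : s ⊆ R.dom) : Agree (σ.symm ⁻¹' s) (((g, σ) : Γ × Perm A.V) • A.str) A.str := by
  have hmem : ∀ y, y ∈ σ.symm ⁻¹' s → (σ.symm y, y) ∈ R := by
    intro y hy
    obtain ⟨z, hz⟩ := hs hy
    have := hσ _ _ hz
    rw [Equiv.apply_symm_apply] at this
    exact this ▸ hz
  refine ⟨fun n r x hx => ?_, fun F y hy => ?_⟩
  · have := h.rel n ((g.1.1 n).symm r) (σ.symm ∘ x) x fun i => hmem _ (hx i)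
    rwa [Equiv.apply_symm_apply] at this
  · ext z
    change σ.symm z ∈ A.str.fn (g.1.2.symm F) (σ.symm y) ↔ _
    constructor
    · intro hz
      obtain ⟨z', hz', hR⟩ := h.fn _ _ _ (hmem y hy) _ hz
      have := hσ _ _ hR
      rw [Equiv.apply_symm_apply] at this
      rw [Equiv.apply_symm_apply] at hz'
      exact this ▸ hz'
    · intro hz
      obtain ⟨z', hz', hR⟩ := h.fn' (g.1.2.symm F) _ _ (hmem y hy) z
        (by rwa [Equiv.apply_symm_apply])
      have := hσ _ _ hR
      rwa [← this, Equiv.symm_apply_apply]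

/-- Finite sets of vertices with an interpretation from the orbit of `S`. -/
def LocalType (Γ : Subgroup L.Perm) {V : Type w} (S : Interp L V) :=
  Finset V × MulAction.orbit (Γ × Perm V) S

instance {V : Type w} (S : Interp L V) : MulAction (Γ × Perm V) (LocalType Γ S) where
  smul p j := (j.1.map p.2.toEmbedding, p • j.2)
  one_smul j := Prod.ext (by
    change j.1.map (Equiv.refl V).toEmbedding = _
    simp) (one_smul _ _)
  mul_smul p q j := Prod.ext (by
    change j.1.map (p.2 * q.2).toEmbedding = (j.1.map q.2.toEmbedding).map p.2.toEmbedding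
    rw [Finset.map_map]
    rfl) (mul_smul _ _ _)

/-- A finite structure with a finite orbit has a finite cover by translates, in which all partial
automorphisms extend coherently, whose group induces partial automorphisms only, and which is
conformal. -/
theorem exists_structure_cover (A : Struc.{u, v, w} L) [Finite A.V]
    (hA : (MulAction.orbit Γ A.str).Finite) :
    ∃ (V : Type w) (_ : Finite V) (H : Subgroup (Γ × Perm V)) (ι : A.V → V),
      Function.Injective ι ∧ HasCoherentExtension H ι (IsPartialAutGraph (Γ := Γ) A) ∧
      (∀ h ∈ H, ∃ σ : Perm A.V, (∀ a b, h.2 (ι a) = ι b → σ a = b) ∧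
        (∀ n (r : L.Rel n) (x : Fin n → A.V), (∀ i, h.2 (ι (x i)) ∈ Set.range ι) →
          (x ∈ A.str.rel n r ↔ σ ∘ x ∈ A.str.rel n (h.1.1.1 n r))) ∧
        ∀ (F : L.Fn) x, h.2 (ι x) ∈ Set.range ι →
          ∀ z, z ∈ A.str.fn F x ↔ σ z ∈ A.str.fn (h.1.1.2 F) (σ x)) ∧
      ∀ S : Set V, (∀ u ∈ S, ∀ v ∈ S, ∃ h ∈ H, h.2 u ∈ Set.range ι ∧ h.2 v ∈ Set.range ι) →
        ∃ h ∈ H, ∀ u ∈ S, h.2 u ∈ Set.range ι := by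
  classical
  have : Finite (MulAction.orbit (Γ × Perm A.V) A.str) := finite_orbit_labelledPerm hA
  have : Finite (LocalType Γ A.str) :=
    inferInstanceAs (Finite (Finset A.V × MulAction.orbit (Γ × Perm A.V) A.str))
  -- Indexing by `Fin` keeps the vertex set of the cover in the universe of `A.V`.
  let e := Finite.equivFin (LocalType Γ A.str)
  let _ : MulAction (Γ × Perm A.V) (Fin (Nat.card (LocalType Γ A.str))) :=
    e.symm.mulAction (Γ × Perm A.V)
  have hsmul : ∀ (p : Γ × Perm A.V) j, e.symm (p • j) = p • e.symm j := fun p j =>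
    e.symm_apply_apply _
  have hmap : ∀ (σ : Perm A.V) (s : Finset A.V),
      (↑(s.map σ.toEmbedding) : Set A.V) = σ.symm ⁻¹' ↑s := by
    intro σ s
    rw [Finset.coe_map]
    exact σ.image_eq_preimage_symm s
  obtain ⟨V, _, H, ι, hι, hext, hH⟩ := exists_parity_cover
    (J := Fin (Nat.card (LocalType Γ A.str))) (fun j => (e.symm j).1)
    (fun p j => by rw [hsmul]; rfl)
    (fun j => Agree (e.symm j).1 (e.symm j).2.1 A.str) (IsPartialAutGraph A) (fun g R h => h.bij)
    (by
      intro g R hR σ hσ j hj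
      rw [hsmul]
      change Agree ↑((e.symm j).1.map σ.toEmbedding) ((g, σ) • (e.symm j).2.1) A.str ↔ _
      rw [hmap]
      have h1 := hR.agree hσ hj
      refine Iff.trans ⟨fun h => h.trans h1.symm, fun h => h.trans h1⟩ (agree_smul_iff (g, σ)))
  obtain ⟨V', hfin, H', ι', π, hι', hext', hπι, hπ, hconf⟩ :=
    exists_conformal_cover H ι hι (IsPartialAutGraph A) (fun g R h => h.bij) hext
  refine ⟨V', hfin, H', ι', hι', hext', ?_, hconf⟩
  intro h hh
  obtain ⟨τ, hτ, hπτ⟩ := hπ h hh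
  obtain ⟨σ, hσ, hgood⟩ := hH _ hτ
  have hι'ι : ∀ a b, h.2 (ι' a) = ι' b → τ (ι a) = ι b := by
    intro a b hab
    rw [← hπι, ← hπι, ← hπτ, hab]
  have hrange : ∀ a, h.2 (ι' a) ∈ Set.range ι' → τ (ι a) ∈ Set.range ι := by
    rintro a ⟨b, hb⟩
    exact ⟨b, (hι'ι a b hb.symm).symm⟩
  have hagree : ∀ s : Finset A.V, s.Nonempty → (∀ a ∈ s, h.2 (ι' a) ∈ Set.range ι') →
      Agree (σ.symm ⁻¹' ↑s) (((h.1, σ) : Γ × Perm A.V) • A.str) A.str := by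
    intro s hs hs'
    -- This local type is good, so its image is good as well, which is the claimed agreement.
    let j : LocalType Γ A.str := (s, ⟨A.str, MulAction.mem_orbit_self _⟩)
    have := hgood (e j)
    rw [hsmul, Equiv.symm_apply_apply] at this
    replace this := this hs fun a ha => hrange a (hs' a ha)
    have := this.2 ⟨fun _ _ _ _ => Iff.rfl, fun _ _ _ => rfl⟩
    rw [← hmap]
    exact this
  refine ⟨σ, fun a b hab => hσ a b (hι'ι a b hab), fun n r x hx => ?_, fun F x hx z => ?_⟩
  -- Positive arity makes the support of the tuple nonempty, as the parity argument requires.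
  · have hn : Nonempty (Fin n) := by
      rcases n with _ | n
      · exact L.rel_zero.elim r
      · exact inferInstance
    have := (hagree (Finset.univ.image x) (Finset.univ_nonempty.image x)
      (by simpa using hx)).1 n (h.1.1.1 n r) (σ ∘ x) (by simp)
    rw [← this]
    exact (mem_smul_rel (h.1, σ) A.str r x).symm
  · have := (hagree {x} (Finset.singleton_nonempty x) (by simpa using hx)).2 (h.1.1.2 F) (σ x)
      (by simp)
    rw [← this]
    exact (mem_smul_fn (h.1, σ) A.str F x z).symm

end Relabel

open Relation (ReflTransGen)

/-! ### The structure glued from translates of `A` -/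

section CoverStructure

variable {L : UnaryLanguage.{u, v}} {Γ : Subgroup L.Perm}

theorem Embedding.ext {A B : Struc.{u, v, w} L} {f g : Embedding Γ A B} (h : f.lang = g.lang)
    (h' : ∀ x, f.toFun x = g.toFun x) : f = g := by
  cases f
  cases g
  obtain rfl : _ = _ := h
  obtain rfl : _ = _ := funext h'
  rfl

/-- `y` lies in the value of some function at `x`. -/
def Struc.Step (A : Struc.{u, v, w} L) (x y : A.V) : Prop :=
  ∃ F, y ∈ A.str.fn F x

/-- The smallest closed set of vertices which contains `a`. -/
def Struc.closure (A : Struc.{u, v, w} L) (a : A.V) : Set A.V :=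
  {b | ReflTransGen A.Step a b}

theorem Struc.closure_subset (A : Struc.{u, v, w} L) {s : Set A.V}
    (hs : ∀ F, ∀ x ∈ s, A.str.fn F x ⊆ s) {a : A.V} (ha : a ∈ s) : A.closure a ⊆ s := by
  intro b hb
  induction hb with
  | refl => exact ha
  | tail _ h ih => exact hs _ _ ih h.choose_spec

/-- The diagonal action of a permutation on vertices with attached sets. -/
def pairMap {V : Type w} (τ : Perm V) (p : V × Set V) : V × Set V :=
  (τ p.1, τ '' p.2)

theorem pairMap_one {V : Type w} (p : V × Set V) : pairMap 1 p = p := by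
  simp [pairMap]

theorem pairMap_mul {V : Type w} (τ τ' : Perm V) (p : V × Set V) :
    pairMap (τ * τ') p = pairMap τ (pairMap τ' p) := by
  simp [pairMap, Set.image_image]

theorem pairMap_inv_eq {V : Type w} (τ : Perm V) (p : V × Set V) :
    pairMap τ⁻¹ (pairMap τ p) = p := by
  rw [← pairMap_mul, inv_mul_cancel, pairMap_one]

/-- A vertex of `A` together with its closure, placed in a cover. -/
def Struc.withClosure (A : Struc.{u, v, w} L) {V : Type w} (ι : A.V → V) (a : A.V) : V × Set V :=
  (ι a, ι '' A.closure a)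

/-- The structure whose vertices are the translates under `H` of vertices of `A` with their
closures, and whose relations and functions are the translates of those of `A`. -/
def coverStruc (A : Struc.{u, v, w} L) {V : Type w} (H : Subgroup (Γ × Perm V)) (ι : A.V → V) :
    Struc.{u, v, w} L where
  V := {p : V × Set V // ∃ h ∈ H, ∃ a, p = pairMap h.2 (A.withClosure ι a)}
  str :=
    { rel := fun n r => {x | ∃ h ∈ H, ∃ (s : L.Rel n) (y : Fin n → A.V), h.1.1.1 n s = r ∧
        y ∈ A.str.rel n s ∧ ∀ i, (x i).1 = pairMap h.2 (A.withClosure ι (y i))}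
      fn := fun F p => {q | ∃ h ∈ H, ∃ (F' : L.Fn) (a b : A.V), h.1.1.2 F' = F ∧
        b ∈ A.str.fn F' a ∧ p.1 = pairMap h.2 (A.withClosure ι a) ∧
          q.1 = pairMap h.2 (A.withClosure ι b)} }

instance (A : Struc.{u, v, w} L) {V : Type w} [Finite V] (H : Subgroup (Γ × Perm V))
    (ι : A.V → V) : Finite (coverStruc A H ι).V :=
  inferInstanceAs (Finite {p : V × Set V // ∃ h ∈ H, ∃ a, p = pairMap h.2 (A.withClosure ι a)})

section

variable {A : Struc.{u, v, w} L} {V : Type w} {H : Subgroup (Γ × Perm V)} {ι : A.V → V}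

/-- The action of `H` on the vertices of the cover structure. -/
def coverMap (ι : A.V → V) {h : Γ × Perm V} (hh : h ∈ H) (p : (coverStruc A H ι).V) :
    (coverStruc A H ι).V :=
  ⟨pairMap h.2 p.1, by
    obtain ⟨k, hk, a, ha⟩ := p.2
    exact ⟨h * k, H.mul_mem hh hk, a, by rw [ha]; exact (pairMap_mul _ _ _).symm⟩⟩

theorem coverMap_inv {h : Γ × Perm V} (hh : h ∈ H) (p : (coverStruc A H ι).V) :
    coverMap ι (H.inv_mem hh) (coverMap ι hh p) = p :=
  Subtype.ext (pairMap_inv_eq _ _)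

theorem coverMap_inv' {h : Γ × Perm V} (hh : h ∈ H) (p : (coverStruc A H ι).V) :
    coverMap ι hh (coverMap ι (H.inv_mem hh) p) = p :=
  Subtype.ext (by
    change pairMap h.2 (pairMap h.2⁻¹ p.1) = p.1
    rw [← pairMap_mul, mul_inv_cancel, pairMap_one])

theorem coverMap_rel {h : Γ × Perm V} (hh : h ∈ H) {n} {r : L.Rel n}
    {x : Fin n → (coverStruc A H ι).V} (hx : x ∈ (coverStruc A H ι).str.rel n r) :
    coverMap ι hh ∘ x ∈ (coverStruc A H ι).str.rel n (h.1.1.1 n r) := by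
  obtain ⟨k, hk, s, y, rfl, hy, hxy⟩ := hx
  refine ⟨h * k, H.mul_mem hh hk, s, y, rfl, hy, fun i => ?_⟩
  change pairMap h.2 (x i).1 = _
  rw [hxy]
  exact (pairMap_mul _ _ _).symm

theorem coverMap_fn {h : Γ × Perm V} (hh : h ∈ H) {F : L.Fn} {p q : (coverStruc A H ι).V}
    (hq : q ∈ (coverStruc A H ι).str.fn F p) :
    coverMap ι hh q ∈ (coverStruc A H ι).str.fn (h.1.1.2 F) (coverMap ι hh p) := by
  obtain ⟨k, hk, F', a, b, rfl, hb, hp, hq⟩ := hq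
  refine ⟨h * k, H.mul_mem hh hk, F', a, b, rfl, hb, ?_, ?_⟩
  · change pairMap h.2 p.1 = _
    rw [hp]
    exact (pairMap_mul _ _ _).symm
  · change pairMap h.2 q.1 = _
    rw [hq]
    exact (pairMap_mul _ _ _).symm

/-- The automorphism of the cover structure induced by an element of `H`. -/
def coverAut (ι : A.V → V) {h : Γ × Perm V} (hh : h ∈ H) :
    Iso Γ (coverStruc A H ι) (coverStruc A H ι) where
  lang := h.1
  toFun := coverMap ι hh
  injective := Function.LeftInverse.injective (coverMap_inv hh)
  surjective := Function.RightInverse.surjective (coverMap_inv' hh)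
  map_rel n r x := by
    refine ⟨coverMap_rel hh, fun hx => ?_⟩
    have := coverMap_rel (H.inv_mem hh) hx
    rw [← Function.comp_assoc, show coverMap ι (H.inv_mem hh) ∘ coverMap ι hh = id from
      funext (coverMap_inv hh)] at this
    change x ∈ (coverStruc A H ι).str.rel n ((h.1.1.1 n).symm (h.1.1.1 n r)) at this
    rwa [Equiv.symm_apply_apply] at this
  map_fn F p := by
    ext q
    constructor
    · rintro ⟨q, hq, rfl⟩
      exact coverMap_fn hh hq
    · intro hq
      refine ⟨coverMap ι (H.inv_mem hh) q, ?_, coverMap_inv' hh q⟩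
      have := coverMap_fn (H.inv_mem hh) hq
      rw [coverMap_inv] at this
      change _ ∈ (coverStruc A H ι).str.fn ((h.1.1.2).symm (h.1.1.2 F)) p at this
      rwa [Equiv.symm_apply_apply] at this

/-- `σ` describes the partial automorphism of `A` which `h` induces. -/
structure Induces (A : Struc.{u, v, w} L) (ι : A.V → V) (h : Γ × Perm V) (σ : Perm A.V) :
    Prop where
  apply_eq : ∀ a b, h.2 (ι a) = ι b → σ a = b
  rel : ∀ n (r : L.Rel n) (x : Fin n → A.V), (∀ i, h.2 (ι (x i)) ∈ Set.range ι) →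
    (x ∈ A.str.rel n r ↔ σ ∘ x ∈ A.str.rel n (h.1.1.1 n r))
  fn : ∀ (F : L.Fn) x, h.2 (ι x) ∈ Set.range ι →
    ∀ z, z ∈ A.str.fn F x ↔ σ z ∈ A.str.fn (h.1.1.2 F) (σ x)

theorem Induces.ι_apply {h : Γ × Perm V} {σ : Perm A.V} (hσ : Induces A ι h σ) {a : A.V}
    (ha : h.2 (ι a) ∈ Set.range ι) : h.2 (ι a) = ι (σ a) := by
  obtain ⟨b, hb⟩ := ha
  rw [← hb, hσ.apply_eq a b hb.symm]

/-- As long as `h` keeps vertices in the base, `σ` matches function steps from them in both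
directions, so it carries the closure of `a` onto that of `σ a`. -/
theorem Induces.pairMap_withClosure {h : Γ × Perm V} {σ : Perm A.V} (hσ : Induces A ι h σ)
    {a : A.V} (ha : ∀ c ∈ A.closure a, h.2 (ι c) ∈ Set.range ι) :
    pairMap h.2 (A.withClosure ι a) = A.withClosure ι (σ a) := by
  have e : σ '' A.closure a = A.closure (σ a) := by
    ext d
    constructor
    · rintro ⟨c, hc, rfl⟩
      change ReflTransGen A.Step a c at hc
      induction hc with
      | refl => exact ReflTransGen.refl
      | tail hc hs ih =>
        obtain ⟨F, hF⟩ := hs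
        exact ReflTransGen.tail ih ⟨_, (hσ.fn F _ (ha _ hc) _).1 hF⟩
    · intro hd
      change ReflTransGen A.Step (σ a) d at hd
      induction hd with
      | refl => exact ⟨a, ReflTransGen.refl, rfl⟩
      | @tail d d' _ hs ih =>
        obtain ⟨c, hc, rfl⟩ := ih
        obtain ⟨F, hF⟩ := hs
        refine ⟨σ.symm d', ?_, σ.apply_symm_apply d'⟩
        refine ReflTransGen.tail hc ⟨h.1.1.2.symm F, ?_⟩
        rwa [hσ.fn _ _ (ha _ hc), Equiv.apply_symm_apply, Equiv.apply_symm_apply]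
  refine Prod.ext (hσ.ι_apply (ha a ReflTransGen.refl)) ?_
  change h.2 '' (ι '' A.closure a) = ι '' A.closure (σ a)
  rw [← e, Set.image_image, Set.image_image]
  exact Set.image_congr fun c hc => hσ.ι_apply (ha c hc)

/-- The embedding of `A` into the cover structure. -/
def coverEmbedding (hι : Function.Injective ι) (hH : ∀ h ∈ H, ∃ σ, Induces A ι h σ) :
    Embedding Γ A (coverStruc A H ι) where
  lang := 1
  toFun a := ⟨A.withClosure ι a, 1, H.one_mem, a, (pairMap_one _).symm⟩
  injective a b h := hι (congrArg (fun p => p.1.1) h)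
  map_rel n r x := by
    constructor
    · intro hx
      exact ⟨1, H.one_mem, r, x, rfl, hx, fun i => (pairMap_one _).symm⟩
    · rintro ⟨h, hh, s, y, hs, hy, hxy⟩
      obtain ⟨σ, hσ⟩ := hH h hh
      have hyx : ∀ i, h.2 (ι (y i)) = ι (x i) := fun i => (congrArg Prod.fst (hxy i)).symm
      have := (hσ.rel n s y fun i => ⟨x i, (hyx i).symm⟩).1 hy
      rw [show σ ∘ y = x from funext fun i => hσ.apply_eq _ _ (hyx i)] at this
      rw [hs] at this
      exact this
  map_fn F x := by
    ext q
    constructor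
    · rintro ⟨b, hb, rfl⟩
      exact ⟨1, H.one_mem, F, x, b, rfl, hb, (pairMap_one _).symm, (pairMap_one _).symm⟩
    · rintro ⟨h, hh, F', a, b, hF, hb, hx, hq⟩
      obtain ⟨σ, hσ⟩ := hH h hh
      have hax : σ a = x := hσ.apply_eq a x (congrArg Prod.fst hx).symm
      -- Here the second coordinate is needed: `h` could move `ι a` to a base vertex without keeping
      -- the closure of `a` in the base.
      have hcl : ∀ c ∈ A.closure a, h.2 (ι c) ∈ Set.range ι := by
        intro c hc
        have : h.2 (ι c) ∈ (A.withClosure ι x).2 := by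
          rw [show A.withClosure ι x = _ from hx]
          exact ⟨_, ⟨c, hc, rfl⟩, rfl⟩
        obtain ⟨d, -, hd⟩ := this
        exact ⟨d, hd⟩
      refine ⟨σ b, ?_, ?_⟩
      · have := (hσ.fn F' a (hcl a ReflTransGen.refl) b).1 hb
        rw [hax, hF] at this
        exact this
      · refine Subtype.ext ?_
        rw [hq, hσ.pairMap_withClosure]
        intro c hc
        exact hcl c (ReflTransGen.head ⟨F', hb⟩ hc)

end

/-! ### Partial automorphisms and their graphs -/

section Graph

variable {A B : Struc.{u, v, w} L}

/-- The graph of a partial automorphism of the image of `ψ`, pulled back along `ψ`. -/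
def PartialAut.graph (p : PartialAut Γ B) (ψ : Embedding Γ A B) : SetRel A.V A.V :=
  {q | ∃ h : ψ.toFun q.1 ∈ p.dom.verts, p.app ⟨ψ.toFun q.1, h⟩ = ψ.toFun q.2}

theorem PartialAut.app_injective (p : PartialAut Γ B) : Function.Injective p.app :=
  Subtype.val_injective.comp p.iso.injective

theorem PartialAut.app_mem (p : PartialAut Γ B) (x : p.dom.verts) : p.app x ∈ p.cod.verts :=
  (p.iso.toFun x).2

theorem PartialAut.app_rel (p : PartialAut Γ B) {n} (r : L.Rel n) (x : Fin n → p.dom.verts) :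
    (fun i => (x i : B.V)) ∈ B.str.rel n r ↔
      (fun i => p.app (x i)) ∈ B.str.rel n (p.iso.lang.1.1 n r) :=
  p.iso.map_rel n r x

theorem PartialAut.app_fn (p : PartialAut Γ B) {F : L.Fn} {x y : p.dom.verts}
    (h : (y : B.V) ∈ B.str.fn F x) : p.app y ∈ B.str.fn (p.iso.lang.1.2 F) (p.app x) := by
  have : p.iso.toFun y ∈ p.iso.toFun '' p.dom.toStruc.str.fn F x := ⟨y, h, rfl⟩
  exact (Set.ext_iff.1 (p.iso.map_fn F x) _).1 this

theorem PartialAut.exists_of_mem_fn (p : PartialAut Γ B) {F : L.Fn} {x : p.dom.verts} {z : B.V}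
    (h : z ∈ B.str.fn (p.iso.lang.1.2 F) (p.app x)) :
    ∃ y : p.dom.verts, (y : B.V) ∈ B.str.fn F x ∧ p.app y = z := by
  have hz : z ∈ p.cod.verts := p.cod.closed _ _ (p.app_mem x) h
  obtain ⟨y, hy, hyz⟩ := (Set.ext_iff.1 (p.iso.map_fn F x) ⟨z, hz⟩).2 h
  exact ⟨y, hy, congrArg Subtype.val hyz⟩

theorem PartialAut.isPartialAutGraph {p : PartialAut Γ B} {ψ : Embedding Γ A B}
    (hψ : ψ.lang = 1) : IsPartialAutGraph A p.iso.lang (p.graph ψ) := by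
  have hrel : ∀ n (r : L.Rel n) x, x ∈ A.str.rel n r ↔ ψ.toFun ∘ x ∈ B.str.rel n r := by
    intro n r x
    have := ψ.map_rel n r x
    rwa [hψ] at this
  have hfn : ∀ (F : L.Fn) x, ψ.toFun '' A.str.fn F x = B.str.fn F (ψ.toFun x) := by
    intro F x
    have := ψ.map_fn F x
    rwa [hψ] at this
  refine ⟨?_, ?_, ?_, ?_⟩
  · rintro a b a' b' ⟨ha, hab⟩ ⟨ha', hab'⟩
    constructor
    · rintro rfl
      exact ψ.injective (hab.symm.trans hab')
    · rintro rfl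
      exact ψ.injective (congrArg Subtype.val (p.app_injective (hab.trans hab'.symm)))
  · intro n r x y hxy
    choose hx hxy using hxy
    rw [hrel, hrel]
    have := p.app_rel r fun i => ⟨ψ.toFun (x i), hx i⟩
    rw [show (fun i => p.app ⟨ψ.toFun (x i), hx i⟩) = ψ.toFun ∘ y from funext hxy] at this
    exact this
  · rintro F x y ⟨hx, hxy⟩ z hz
    have h1 : ψ.toFun z ∈ B.str.fn F (ψ.toFun x) := by
      rw [← hfn]
      exact ⟨z, hz, rfl⟩
    have h2 : ψ.toFun z ∈ p.dom.verts := p.dom.closed _ _ hx h1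
    have h3 := p.app_fn (x := ⟨_, hx⟩) (y := ⟨_, h2⟩) h1
    rw [hxy, ← hfn] at h3
    obtain ⟨z', hz', e⟩ := h3
    exact ⟨z', hz', h2, e.symm⟩
  · rintro F x y ⟨hx, hxy⟩ z' hz'
    have h1 : ψ.toFun z' ∈ B.str.fn (p.iso.lang.1.2 F) (p.app ⟨_, hx⟩) := by
      rw [hxy, ← hfn]
      exact ⟨z', hz', rfl⟩
    obtain ⟨w, hw, hwz⟩ := p.exists_of_mem_fn h1
    rw [← hfn] at hw
    obtain ⟨z, hz, e⟩ := hw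
    obtain ⟨w, hw'⟩ := w
    obtain rfl : ψ.toFun z = w := e
    exact ⟨z, hz, hw', hwz⟩

theorem PartialAut.exists_mem_graph {p : PartialAut Γ B} {ψ : Embedding Γ A B}
    (hp : p.IsOn ψ.range) {a : A.V} (ha : ψ.toFun a ∈ p.dom.verts) : ∃ b, (a, b) ∈ p.graph ψ := by
  obtain ⟨b, hb⟩ := hp.2 (p.app_mem ⟨_, ha⟩)
  exact ⟨b, ha, hb.symm⟩

theorem CoherentTriple.graph_cod {f g h : PartialAut Γ B} (H : CoherentTriple f g h)
    {ψ : Embedding Γ A B} (hf : f.IsOn ψ.range) (hg : g.IsOn ψ.range) :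
    (f.graph ψ).cod = (g.graph ψ).dom := by
  ext b
  constructor
  · rintro ⟨a, ha, hab⟩
    refine PartialAut.exists_mem_graph hg ?_
    rw [← H.2.1, ← hab]
    exact f.app_mem _
  · rintro ⟨c, hb, -⟩
    have hb' : ψ.toFun b ∈ f.cod.verts := H.2.1 ▸ hb
    obtain ⟨⟨x, hx⟩, hxb⟩ := f.iso.surjective ⟨_, hb'⟩
    obtain ⟨a, rfl⟩ := hf.1 hx
    exact ⟨a, hx, congrArg Subtype.val hxb⟩

theorem CoherentTriple.graph_comp {f g h : PartialAut Γ B} (H : CoherentTriple f g h)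
    {ψ : Embedding Γ A B} (hf : f.IsOn ψ.range) :
    h.graph ψ = (f.graph ψ).comp (g.graph ψ) := by
  ext ⟨a, c⟩
  constructor
  · rintro ⟨ha, hac⟩
    have ha' : ψ.toFun a ∈ f.dom.verts := H.1 ▸ ha
    obtain ⟨b, hb, hab⟩ := PartialAut.exists_mem_graph hf ha'
    have hb' : ψ.toFun b ∈ g.dom.verts := by
      rw [← H.2.1, ← hab]
      exact f.app_mem _
    refine ⟨b, ⟨hb, hab⟩, hb', ?_⟩
    rw [← hac]
    exact (H.2.2.2.2 ⟨_, ha'⟩ ⟨_, hb'⟩ ⟨_, ha⟩ rfl hab.symm).symm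
  · rintro ⟨b, ⟨ha, hab⟩, hb, hbc⟩
    have ha' : ψ.toFun a ∈ h.dom.verts := H.1 ▸ ha
    refine ⟨ha', ?_⟩
    rw [← hbc]
    exact H.2.2.2.2 ⟨_, ha⟩ ⟨_, hb⟩ ⟨_, ha'⟩ rfl hab.symm

end Graph

/-! ### Extension and faithfulness -/

/-- The vertices from which `x` cannot be reached form a proper substructure, and likewise for `y`.
If the conclusion fails, these two cover `C` and no related tuple meets both differences, so `C` is
their free amalgamation. -/
theorem Irreducible.exists_descendants {C : Struc.{u, v, w} L} (hC : Irreducible Γ C) (x y : C.V) :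
    (∃ z, ReflTransGen C.Step z x ∧ ReflTransGen C.Step z y) ∨
      ∃ n, ∃ (r : L.Rel n) (t : Fin n → C.V), t ∈ C.str.rel n r ∧
        ∃ i j, ReflTransGen C.Step (t i) x ∧ ReflTransGen C.Step (t j) y := by
  by_contra hcon
  rw [not_or] at hcon
  let U : C.V → Substruc C := fun x =>
    { verts := {z | ¬ ReflTransGen C.Step z x}
      closed := fun F z hz y hy h => hz (ReflTransGen.head ⟨F, hy⟩ h) }
  refine hC ⟨U x, U y, ?_, ?_, ⟨rfl, ?_⟩, ?_, ?_⟩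
  · intro h
    have : x ∈ (U x).verts := h ▸ trivial
    exact this ReflTransGen.refl
  · intro h
    have : y ∈ (U y).verts := h ▸ trivial
    exact this ReflTransGen.refl
  · rintro ⟨a, ha⟩ ⟨b, hb⟩
    constructor
    · intro h
      obtain rfl : a = b := h
      exact ⟨⟨a, ha, hb⟩, rfl, rfl⟩
    · rintro ⟨c, h1, h2⟩
      exact (congrArg Subtype.val h1).symm.trans (congrArg Subtype.val h2)
  · rw [Set.eq_univ_iff_forall]
    intro z
    by_cases hz : ReflTransGen C.Step z x
    · exact Or.inr ⟨⟨z, fun h => hcon.1 ⟨z, hz, h⟩⟩, rfl⟩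
    · exact Or.inl ⟨⟨z, hz⟩, rfl⟩
  · rintro n r t ⟨i, ⟨a, ha⟩, hai, hti⟩ ⟨j, ⟨b, hb⟩, hbj, htj⟩ ht
    refine hcon.2 ⟨n, r, t, ht, j, i, ?_, ?_⟩
    · by_contra h
      obtain rfl : b = t j := htj
      exact hbj ⟨⟨t j, h, hb⟩, rfl⟩
    · by_contra h
      obtain rfl : a = t i := hti
      exact hai ⟨⟨t i, ha, h⟩, rfl⟩

/-- The domain of a partial automorphism contains the closures of its vertices, so the extension in
`H` keeps these in the base and moves vertices correctly together with their closures. Coherence is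
inherited from `H`. -/
theorem coverEmbedding_isCoherent {A : Struc.{u, v, w} L} {V : Type w} {H : Subgroup (Γ × Perm V)}
    {ι : A.V → V} (hι : Function.Injective ι) (hH : ∀ h ∈ H, ∃ σ, Induces A ι h σ)
    (hext : HasCoherentExtension H ι (IsPartialAutGraph (Γ := Γ) A)) :
    IsCoherentEPPAEmbedding (coverEmbedding hι hH) := by
  set ψ := coverEmbedding hι hH with hψ
  obtain ⟨E, hE, hE'⟩ := hext
  have hgr : ∀ p : {p : PartialAut Γ (coverStruc A H ι) // p.IsOn ψ.range},
      IsPartialAutGraph A p.1.iso.lang (p.1.graph ψ) := fun _ =>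
    PartialAut.isPartialAutGraph rfl
  refine ⟨fun p => coverAut ι (hE _ _ (hgr p)).1, fun p => ⟨rfl, ?_⟩, ?_⟩
  · rintro ⟨x, hx⟩
    obtain ⟨a, rfl⟩ := p.2.1 hx
    obtain ⟨b, hab⟩ := PartialAut.exists_mem_graph p.2 hx
    obtain ⟨hm, hE1⟩ := hE _ _ (hgr p)
    obtain ⟨σ, hσ⟩ := hH _ hm
    have hcl : A.closure a ⊆ (p.1.graph ψ).dom := by
      refine A.closure_subset ?_ ⟨b, hab⟩
      rintro F y ⟨y', hy⟩ z hz
      obtain ⟨z', -, hzz⟩ := (hgr p).fn F y y' hy z hz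
      exact ⟨z', hzz⟩
    refine Eq.trans (Subtype.ext ?_) hab.2.symm
    change pairMap _ (A.withClosure ι a) = A.withClosure ι b
    rw [← hσ.apply_eq a b (hE1 a b hab)]
    refine hσ.pairMap_withClosure fun c hc => ?_
    obtain ⟨d, hd⟩ := hcl hc
    exact ⟨d, (hE1 c d hd).symm⟩
  · intro f g h hfgh
    have hcod := hfgh.graph_cod f.2 g.2
    have hcomp := hfgh.graph_comp f.2
    have hlang := hfgh.2.2.2.1
    have key := hE' _ _ _ _ (hgr f) (hgr g) hcod
    rw [← hcomp, ← hlang] at key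
    refine Embedding.ext hlang fun x => Subtype.ext ?_
    change pairMap (E _ _) x.1 = pairMap (E _ _) (pairMap (E _ _) x.1)
    rw [key, pairMap_mul]

/-- Translates of `A` are closed under functions, so a common ancestor or a related tuple of
ancestors puts two vertices of `C` into one translate. Conformality then moves all first coordinates
of `C` into the base at once. -/
theorem coverEmbedding_isFaithful {A : Struc.{u, v, w} L} {V : Type w} {H : Subgroup (Γ × Perm V)}
    {ι : A.V → V} (hι : Function.Injective ι) (hH : ∀ h ∈ H, ∃ σ, Induces A ι h σ)
    (hconf : ∀ S : Set V,
      (∀ u ∈ S, ∀ v ∈ S, ∃ h ∈ H, h.2 u ∈ Set.range ι ∧ h.2 v ∈ Set.range ι) →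
        ∃ h ∈ H, ∀ u ∈ S, h.2 u ∈ Set.range ι) :
    IsIrreducibleStructureFaithful (coverEmbedding hι hH) := by
  intro C hC
  set ψ := coverEmbedding hι hH with hψ
  have hdesc : ∀ {h : Γ × Perm V} (hh : h ∈ H) (z y : C.toStruc.V),
      ReflTransGen C.toStruc.Step z y → (∃ a, z.1.1 = pairMap h.2 (A.withClosure ι a)) →
        ∃ a, y.1.1 = pairMap h.2 (A.withClosure ι a) := by
    rintro h hh z y hzy ⟨a, ha⟩
    induction hzy with
    | refl => exact ⟨a, ha⟩
    | @tail y y' _ hs ih =>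
      obtain ⟨a, ha⟩ := ih
      obtain ⟨F, hF⟩ := hs
      have hy : y.1 ∈ ((coverAut ι hh).toEmbedding.comp ψ).range.verts :=
        ⟨a, Subtype.ext ha.symm⟩
      obtain ⟨b, hb⟩ := ((coverAut ι hh).toEmbedding.comp ψ).range.closed F _ hy hF
      exact ⟨b, (congrArg Subtype.val hb).symm⟩
  have hpair : ∀ x y : C.toStruc.V, ∃ h ∈ H, (∃ a, x.1.1 = pairMap h.2 (A.withClosure ι a)) ∧
      ∃ a, y.1.1 = pairMap h.2 (A.withClosure ι a) := by
    intro x y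
    rcases hC.exists_descendants x y with ⟨z, hzx, hzy⟩ | ⟨n, r, t, ht, i, j, hi, hj⟩
    · obtain ⟨h, hh, a, ha⟩ := z.1.2
      exact ⟨h, hh, hdesc hh z x hzx ⟨a, ha⟩, hdesc hh z y hzy ⟨a, ha⟩⟩
    · obtain ⟨h, hh, s, q, -, -, hq⟩ := ht
      exact ⟨h, hh, hdesc hh _ x hi ⟨_, hq i⟩, hdesc hh _ y hj ⟨_, hq j⟩⟩
  obtain ⟨h, hh, hS⟩ := hconf ((fun x => x.1.1) '' C.verts) (by
    rintro _ ⟨x, hx, rfl⟩ _ ⟨y, hy, rfl⟩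
    obtain ⟨h, hh, ⟨a, ha⟩, ⟨b, hb⟩⟩ := hpair ⟨x, hx⟩ ⟨y, hy⟩
    refine ⟨h⁻¹, H.inv_mem hh, ⟨a, ?_⟩, ⟨b, ?_⟩⟩
    · exact ((Equiv.symm_apply_eq h.2).2 (congrArg Prod.fst ha)).symm
    · exact ((Equiv.symm_apply_eq h.2).2 (congrArg Prod.fst hb)).symm)
  refine ⟨coverAut ι hh, ?_⟩
  rintro _ ⟨x, hx, rfl⟩
  obtain ⟨k, hk, a, ha⟩ := x.2
  obtain ⟨σ, hσ⟩ := hH (h * k) (H.mul_mem hh hk)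
  refine ⟨σ a, Subtype.ext ?_⟩
  change A.withClosure ι (σ a) = pairMap h.2 x.1
  rw [ha, ← pairMap_mul]
  refine (hσ.pairMap_withClosure fun c hc => ?_).symm
  -- The second coordinates follow: `C` is closed, so the closure of each of its vertices is in `C`
  -- and is moved into the base too.
  have hcC : A.closure a ⊆ {c | (coverAut ι hk).toFun (ψ.toFun c) ∈ C.verts} := by
    refine A.closure_subset ?_ ?_
    · intro F c hc d hd
      exact C.closed _ _ hc ((Set.ext_iff.1 (((coverAut ι hk).toEmbedding.comp ψ).map_fn F c)
        _).1 ⟨d, hd, rfl⟩)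
    · have : (coverAut ι hk).toFun (ψ.toFun a) = x := Subtype.ext ha.symm
      change (coverAut ι hk).toFun (ψ.toFun a) ∈ C.verts
      rwa [this]
  exact hS _ ⟨_, hcC hc, rfl⟩

/-- A finite structure which lies in a finite orbit of the action by relabelling has a finite
irreducible structure faithful coherent EPPA-witness. -/
theorem exists_faithful_coherent_witness (A : Struc.{u, v, w} L) [Finite A.V]
    (hA : (MulAction.orbit Γ A.str).Finite) :
    ∃ B : Struc.{u, v, w} L, Finite B.V ∧ ∃ ψ : Embedding Γ A B,
      IsCoherentEPPAEmbedding ψ ∧ IsIrreducibleStructureFaithful ψ := by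
  obtain ⟨V, _, H, ι, hι, hext, hH, hconf⟩ := exists_structure_cover A hA
  have hH' : ∀ h ∈ H, ∃ σ, Induces A ι h σ := by
    intro h hh
    obtain ⟨σ, h1, h2, h3⟩ := hH h hh
    exact ⟨σ, h1, h2, h3⟩
  exact ⟨coverStruc A H ι, inferInstance, coverEmbedding hι hH',
    coverEmbedding_isCoherent hι hH' hext, coverEmbedding_isFaithful hι hH' hconf⟩

end CoverStructure

/-! ### Free amalgamation classes and the two implications -/

section Classes

variable {L : UnaryLanguage.{u, v}} {Γ : Subgroup L.Perm}

/-- A structure which is the free amalgamation of two substructures embeds into every free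
amalgamation of them. -/
theorem IsFreeAmalgamation.nonempty_embedding {B C : Struc.{u, v, w} L} {S T : Substruc B}
    (hB : IsFreeAmalgamation
      (Substruc.inclusion Γ (S := S.inter T) (T := S) Set.inter_subset_left)
      (Substruc.inclusion Γ (S := S.inter T) (T := T) Set.inter_subset_right)
      (S.subtype Γ) (T.subtype Γ))
    {β₁ : Embedding Γ S.toStruc C} {β₂ : Embedding Γ T.toStruc C}
    (hC : IsFreeAmalgamation
      (Substruc.inclusion Γ (S := S.inter T) (T := S) Set.inter_subset_left)
      (Substruc.inclusion Γ (S := S.inter T) (T := T) Set.inter_subset_right) β₁ β₂) :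
    Nonempty (Embedding Γ B C) := by
  classical
  obtain ⟨-, hBun, hBrel⟩ := hB
  obtain ⟨⟨hcomp, hstrong⟩, -, hCrel⟩ := hC
  have hun : ∀ x, x ∉ S.verts → x ∈ T.verts := by
    intro x hx
    have : x ∈ Set.range (S.subtype Γ).toFun ∪ Set.range (T.subtype Γ).toFun := hBun ▸ trivial
    rcases this with ⟨y, rfl⟩ | ⟨y, rfl⟩
    · exact absurd y.2 hx
    · exact y.2
  have hlang : β₂.lang = β₁.lang := by
    have : β₁.lang * 1 = β₂.lang * 1 := congrArg Embedding.lang hcomp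
    rwa [mul_one, mul_one, eq_comm] at this
  have hst : ∀ x y (hx : x ∈ S.verts) (hy : y ∈ T.verts),
      β₁.toFun ⟨x, hx⟩ = β₂.toFun ⟨y, hy⟩ ↔ x = y := by
    intro x y hx hy
    refine (hstrong _ _).trans ⟨?_, ?_⟩
    · rintro ⟨a, h1, h2⟩
      exact (congrArg Subtype.val h1).symm.trans (congrArg Subtype.val h2)
    · rintro rfl
      exact ⟨⟨x, hx, hy⟩, rfl, rfl⟩
  let f : B.V → C.V := fun x =>
    if h : x ∈ S.verts then β₁.toFun ⟨x, h⟩ else β₂.toFun ⟨x, hun x h⟩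
  have f1 : ∀ x (h : x ∈ S.verts), f x = β₁.toFun ⟨x, h⟩ := fun x h => dif_pos h
  have f2 : ∀ x (h : x ∈ T.verts), f x = β₂.toFun ⟨x, h⟩ := by
    intro x h
    by_cases h' : x ∈ S.verts
    · exact (f1 x h').trans ((hst x x h' h).2 rfl)
    · exact dif_neg h'
  have hinj : Function.Injective f := by
    intro x y hxy
    by_cases hx : x ∈ S.verts <;> by_cases hy : y ∈ S.verts
    · rw [f1 x hx, f1 y hy] at hxy
      exact congrArg Subtype.val (β₁.injective hxy)
    · rw [f1 x hx, f2 y (hun y hy)] at hxy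
      exact (hst x y hx (hun y hy)).1 hxy
    · rw [f2 x (hun x hx), f1 y hy] at hxy
      exact ((hst y x hy (hun x hx)).1 hxy.symm).symm
    · rw [f2 x (hun x hx), f2 y (hun y hy)] at hxy
      exact congrArg Subtype.val (β₂.injective hxy)
  have rel1 : ∀ n (r : L.Rel n) (x : Fin n → B.V), (∀ i, x i ∈ S.verts) →
      (x ∈ B.str.rel n r ↔ f ∘ x ∈ C.str.rel n (β₁.lang.1.1 n r)) := by
    intro n r x hx
    have := β₁.map_rel n r fun i => ⟨x i, hx i⟩
    rwa [show (β₁.toFun ∘ fun i => ⟨x i, hx i⟩) = f ∘ x from funext fun i => (f1 _ (hx i)).symm]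
      at this
  have rel2 : ∀ n (r : L.Rel n) (x : Fin n → B.V), (∀ i, x i ∈ T.verts) →
      (x ∈ B.str.rel n r ↔ f ∘ x ∈ C.str.rel n (β₁.lang.1.1 n r)) := by
    intro n r x hx
    have := β₂.map_rel n r fun i => ⟨x i, hx i⟩
    rwa [show (β₂.toFun ∘ fun i => ⟨x i, hx i⟩) = f ∘ x from funext fun i => (f2 _ (hx i)).symm,
      hlang] at this
  have fn1 : ∀ (F : L.Fn) (U : Substruc B) (β : Embedding Γ U.toStruc C),
      β.lang = β₁.lang → (∀ x (h : x ∈ U.verts), f x = β.toFun ⟨x, h⟩) → ∀ x ∈ U.verts,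
      f '' B.str.fn F x = C.str.fn (β₁.lang.1.2 F) (f x) := by
    intro F U β hβ hf x hx
    rw [hf x hx, ← hβ]
    refine Eq.trans ?_ (β.map_fn F ⟨x, hx⟩)
    ext y
    constructor
    · rintro ⟨z, hz, rfl⟩
      exact ⟨⟨z, U.closed F x hx hz⟩, hz, (hf _ _).symm⟩
    · rintro ⟨⟨z, hz'⟩, hz, rfl⟩
      exact ⟨z, hz, hf _ _⟩
  refine ⟨⟨β₁.lang, f, hinj, fun n r x => ?_, fun F x => ?_⟩⟩
  · by_cases hS : ∀ i, x i ∈ S.verts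
    · exact rel1 n r x hS
    by_cases hT : ∀ i, x i ∈ T.verts
    · exact rel2 n r x hT
    rw [not_forall] at hS hT
    obtain ⟨i, hi⟩ := hS
    obtain ⟨j, hj⟩ := hT
    have hi' := hun _ hi
    have hj' : x j ∈ S.verts := by
      by_contra h
      exact hj (hun _ h)
    have n1 : (⟨x j, hj'⟩ : S.verts) ∈ (Set.range (Substruc.inclusion Γ (S := S.inter T) (T := S)
        Set.inter_subset_left).toFun)ᶜ := by
      rintro ⟨⟨a, _, haT⟩, ha⟩
      obtain rfl : a = x j := congrArg Subtype.val ha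
      exact hj haT
    have n2 : (⟨x i, hi'⟩ : T.verts) ∈ (Set.range (Substruc.inclusion Γ (S := S.inter T) (T := T)
        Set.inter_subset_right).toFun)ᶜ := by
      rintro ⟨⟨a, haS, _⟩, ha⟩
      obtain rfl : a = x i := congrArg Subtype.val ha
      exact hi haS
    -- A tuple meeting both sides is in no relation of either amalgamation.
    exact iff_of_false (hBrel n r x ⟨j, ⟨_, n1, rfl⟩⟩ ⟨i, ⟨_, n2, rfl⟩⟩)
      (hCrel n _ (f ∘ x) ⟨j, ⟨_, n1, (f1 _ hj').symm⟩⟩ ⟨i, ⟨_, n2, (f2 _ hi').symm⟩⟩)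
  · by_cases hx : x ∈ S.verts
    · exact fn1 F S β₁ rfl f1 x hx
    · exact fn1 F T β₂ hlang f2 x (hun x hx)

/-- A substructure of a substructure, as a substructure. -/
def Substruc.lift {B : Struc.{u, v, w} L} {S : Substruc B} (T : Substruc S.toStruc) :
    Substruc B where
  verts := {x | ∃ h : x ∈ S.verts, (⟨x, h⟩ : S.verts) ∈ T.verts}
  closed := by
    rintro F x ⟨hx, hx'⟩ y hy
    exact ⟨S.closed F x hx hy, T.closed F _ hx' (by exact hy)⟩

theorem Substruc.nonempty_embedding_lift {B : Struc.{u, v, w} L} {S : Substruc B}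
    (T : Substruc S.toStruc) : Nonempty (Embedding Γ T.toStruc (Substruc.lift T).toStruc) := by
  refine ⟨⟨1, fun x => ⟨x.1.1, x.1.2, x.2⟩, fun x y h => ?_, fun n r x => Iff.rfl, fun F x => ?_⟩⟩
  · have h' : x.1.1 = y.1.1 := congrArg (fun z : (Substruc.lift T).toStruc.V => z.1) h
    exact Subtype.ext (Subtype.ext h')
  · ext ⟨y, hy, hy'⟩
    constructor
    · rintro ⟨z, hz, hzy⟩
      rw [← hzy]
      exact hz
    · intro h
      exact ⟨⟨⟨y, hy⟩, hy'⟩, h, rfl⟩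

/-- A finite structure belongs to a free amalgamation class if its irreducible substructures do. -/
theorem IsFreeAmalgamationClass.mem_of_irreducible {K : Set (Struc.{u, v, w} L)}
    (hK : IsFreeAmalgamationClass Γ K) {B : Struc.{u, v, w} L} [Finite B.V]
    (h : ∀ S : Substruc B, Irreducible Γ S.toStruc → S.toStruc ∈ K) : B ∈ K := by
  have key : ∀ n, ∀ S : Substruc B, S.verts.ncard = n → S.toStruc ∈ K := by
    intro n
    induction n using Nat.strong_induction_on with
    | _ n ih =>
      -- Induction on size: a reducible substructure is a free amalgamation of smaller ones, which
      -- are in `K`, and embeds into a free amalgamation of them chosen in `K`.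
      intro S hS
      by_cases hirr : Irreducible Γ S.toStruc
      · exact h S hirr
      obtain ⟨T, U, hT, hU, hfree⟩ := not_not.1 hirr
      have hmem : ∀ T : Substruc S.toStruc, T.verts ≠ Set.univ → T.toStruc ∈ K := by
        intro T hT
        refine hK.hereditary _ (ih (Substruc.lift T).verts.ncard ?_ (Substruc.lift T) rfl) _
          (Substruc.nonempty_embedding_lift T)
        rw [← hS]
        refine Set.ncard_lt_ncard ⟨fun x hx => hx.1, fun hs => hT ?_⟩ (Set.toFinite _)
        rw [Set.eq_univ_iff_forall]
        intro x
        exact (hs x.2).2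
      have hTK := hmem T hT
      obtain ⟨C, hC, β₁, β₂, hβ⟩ := hK.free_amalgamation (T.inter U).toStruc
        (hK.hereditary _ hTK _ ⟨Substruc.inclusion Γ Set.inter_subset_left⟩) _ hTK _ (hmem U hU)
        (Substruc.inclusion Γ Set.inter_subset_left) (Substruc.inclusion Γ Set.inter_subset_right)
      exact hK.hereditary _ hC _ (hfree.nonempty_embedding hβ)
  refine hK.hereditary _ (key _ ⟨Set.univ, fun _ _ _ => Set.subset_univ _⟩ rfl) _
    ⟨⟨1, fun x => ⟨x, trivial⟩, fun x y h => congrArg Subtype.val h, fun n r x => Iff.rfl,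
      fun F x => ?_⟩⟩
  ext y
  constructor
  · rintro ⟨z, hz, rfl⟩
    exact hz
  · intro hy
    exact ⟨y.1, hy, rfl⟩

/-- Only membership of the witness in `K` remains: an automorphism moves each irreducible
substructure into `ψ(A)`, and composing with the inverse of `ψ` embeds it into `A`. -/
theorem IsFreeAmalgamationClass.hasFaithfulCoherentEPPA {K : Set (Struc.{u, v, w} L)}
    (hK : IsFreeAmalgamationClass Γ K) (h : ∀ A ∈ K, (MulAction.orbit Γ A.str).Finite) :
    HasFaithfulCoherentEPPA Γ K := by
  intro A hA
  have := hK.finite A hA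
  obtain ⟨B, _, ψ, hψ, hfaith⟩ := exists_faithful_coherent_witness A (h A hA)
  refine ⟨B, hK.mem_of_irreducible fun S hS => ?_, ψ, hψ, hfaith⟩
  obtain ⟨g, hg⟩ := hfaith S hS
  choose f hf using fun x : S.toStruc.V => hg ⟨x.1, x.2, rfl⟩
  let k : Γ := ψ.lang⁻¹ * g.lang
  have hk1 : ∀ n (r : L.Rel n), ψ.lang.1.1 n (k.1.1 n r) = g.lang.1.1 n r := fun n r =>
    Equiv.apply_symm_apply (ψ.lang.1.1 n) _
  have hk2 : ∀ F : L.Fn, ψ.lang.1.2 (k.1.2 F) = g.lang.1.2 F := fun F =>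
    Equiv.apply_symm_apply ψ.lang.1.2 _
  refine hK.hereditary A hA _ ⟨⟨k, f, fun x y hxy => ?_, fun n r x => ?_, fun F x => ?_⟩⟩
  · have := hf x
    rw [hxy, hf y] at this
    exact Subtype.ext (g.injective this.symm)
  · rw [ψ.map_rel, hk1]
    refine (g.map_rel n r fun i => (x i).1).trans ?_
    rw [show ψ.toFun ∘ f ∘ x = g.toFun ∘ fun i => (x i).1 from funext fun i => hf (x i)]
  · apply ψ.injective.image_injective
    rw [ψ.map_fn, hk2, hf, ← g.map_fn, Set.image_image]
    ext y
    constructor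
    · rintro ⟨z, hz, rfl⟩
      exact ⟨z.1, hz, (hf z).symm⟩
    · rintro ⟨z, hz, rfl⟩
      exact ⟨⟨z, S.closed F _ x.2 hz⟩, hz, hf _⟩

/-- A partial automorphism with empty domain and an arbitrary language part. -/
def PartialAut.ofLang (B : Struc.{u, v, w} L) (g : Γ) : PartialAut Γ B where
  dom := ⟨∅, fun _ _ h => h.elim⟩
  cod := ⟨∅, fun _ _ h => h.elim⟩
  iso :=
    { lang := g
      toFun := id
      injective := Function.injective_id
      map_rel := fun n r x => by
        rcases n with _ | n
        · exact L.rel_zero.elim r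
        · exact (x 0).2.elim
      map_fn := fun F x => x.2.elim
      surjective := Function.surjective_id }

theorem IsEPPAEmbedding.finite_orbit {A B : Struc.{u, v, w} L} [Finite A.V] [Finite B.V]
    {ψ : Embedding Γ A B} (hψ : IsEPPAEmbedding ψ) : (MulAction.orbit Γ A.str).Finite := by
  let pull : (A.V → B.V) → Interp L A.V := fun m =>
    { rel := fun n r => {x | m ∘ x ∈ B.str.rel n (ψ.lang.1.1 n r)}
      fn := fun F x => m ⁻¹' B.str.fn (ψ.lang.1.2 F) (m x) }
  refine (Set.finite_range pull).subset ?_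
  rintro _ ⟨g, rfl⟩
  -- The conjugation gives `θ ∘ ψ` the language part `ψ.lang * g`, so pulling back along its vertex
  -- map yields `g • A.str`.
  obtain ⟨θ, hθ, -⟩ := hψ (PartialAut.ofLang B (ψ.lang * g * ψ.lang⁻¹))
    ⟨Set.empty_subset _, Set.empty_subset _⟩
  have hθ : θ.lang = ψ.lang * g * ψ.lang⁻¹ := hθ
  have hlang : (θ.toEmbedding.comp ψ).lang = ψ.lang * g := by
    change θ.lang * ψ.lang = _
    rw [hθ, inv_mul_cancel_right]
  have h1 : ∀ n (r : L.Rel n),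
      (θ.toEmbedding.comp ψ).lang.1.1 n ((g⁻¹).1.1 n r) = ψ.lang.1.1 n r := by
    intro n r
    rw [hlang]
    exact congrArg _ (Equiv.apply_symm_apply (g.1.1 n) r)
  have h2 : ∀ F : L.Fn, (θ.toEmbedding.comp ψ).lang.1.2 ((g⁻¹).1.2 F) = ψ.lang.1.2 F := by
    intro F
    rw [hlang]
    exact congrArg _ (Equiv.apply_symm_apply g.1.2 F)
  refine ⟨(θ.toEmbedding.comp ψ).toFun, Interp.ext ?_ ?_⟩
  · funext n r
    ext x
    have := (θ.toEmbedding.comp ψ).map_rel n ((g⁻¹).1.1 n r) x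
    rw [h1] at this
    exact this.symm
  · funext F x
    have := (θ.toEmbedding.comp ψ).map_fn ((g⁻¹).1.2 F) x
    rw [h2] at this
    change (θ.toEmbedding.comp ψ).toFun ⁻¹' B.str.fn (ψ.lang.1.2 F) _ = A.str.fn ((g⁻¹).1.2 F) x
    rw [← this, Set.preimage_image_eq _ (θ.toEmbedding.comp ψ).injective]

theorem HasFaithfulCoherentEPPA.hasEPPA {K : Set (Struc.{u, v, w} L)}
    (h : HasFaithfulCoherentEPPA Γ K) : HasEPPA Γ K := by
  intro A hA
  obtain ⟨B, hB, ψ, ⟨φ, hφ, -⟩, -⟩ := h A hA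
  exact ⟨B, hB, ψ, fun p hp => ⟨φ ⟨p, hp⟩, hφ ⟨p, hp⟩⟩⟩

end Classes

end GammaL

theorem corollary1p4 (L : GammaL.UnaryLanguage.{u, v}) (Γ : Subgroup L.Perm)
    (K : Set (GammaL.Struc.{u, v, w} L)) (hK : GammaL.IsFreeAmalgamationClass Γ K) :
    (GammaL.HasEPPA Γ K ↔ ∀ A ∈ K, (MulAction.orbit Γ A.str).Finite) ∧
      (GammaL.HasEPPA Γ K → GammaL.HasFaithfulCoherentEPPA Γ K) := by
  have h : GammaL.HasEPPA Γ K → ∀ A ∈ K, (MulAction.orbit Γ A.str).Finite := by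
    intro h A hA
    obtain ⟨B, hB, ψ, hψ⟩ := h A hA
    have := hK.finite A hA
    have := hK.finite B hB
    exact hψ.finite_orbit
  exact ⟨⟨h, fun h => (hK.hasFaithfulCoherentEPPA h).hasEPPA⟩,
    fun h' => hK.hasFaithfulCoherentEPPA (h h')⟩
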